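/- Let $\mathcal L$ be a first-order language containing a binary relation symbol for a linear order, let $\mathcal A=(A,<,\dots)$ be an o-minimal $\mathcal L$-structure (that is, $<$ linearly orders $A$ and every subset of $A$ definable in $\mathcal A$ with parameters is a finite union of points and open intervals with endpoints in $A\cup\{\pm\infty\}$), and let $B\subseteq A$. Let $\mathcal L(U)=\mathcal L\cup\{U\}$, where $U$ is a unary relation symbol not in $\mathcal L$, and let $T_B$ be the complete $\mathcal L(U)$-theory of $(\mathcal A,B)$, where $U$ is interpreted as $B$. "Definable" means definable with parameters unless stated otherwise. Suppose that for every model $(\mathcal M,N)$ of $T_B$ (where $\mathcal M$ is an $\mathcal L$-structure with underlying set $M$ and $N\subseteq M$ is the interpretation of $U$) the following hold: (i) for every $n\ge 0$, every subset of $N^n$ definable in $(\mathcal M,N)$ is a boolean combination of sets of the form $S\cap K$, where $S\subseteq M^n$ is definable in $\mathcal M$ and $K\subseteq M^n$ is definable in $(\mathcal M,N)$ without parameters; (ii) every subset of $M$ definable in $(\mathcal M,N)$ is a boolean combination of subsets of $M$ defined by formulas $$\exists y_1\cdots\exists y_q\;\bigl(U(y_1)\wedge\dots\wedge U(y_q)\wedge\varphi(x,y_1,\dots,y_q)\bigr),$$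 where $q\ge 0$, $x,y_1,\dots,y_q$ are distinct variables and $\varphi$ is a quantifier-free $\mathcal L$-formula with parameters from $M$; (iii) every subset of $M$ that is definable in $(\mathcal M,N)$ and open in the order topology is a finite union of open intervals with endpoints in $M\cup\{\pm\infty\}$. Then $T_B$ is dependent (has NIP): for every $\mathcal L(U)$-formula $\psi(\vec x,\vec y)$ with $|\vec x|=p$ and $|\vec y|=q$, every model $\mathbb M$ of $T_B$, every indiscernible sequence $(\vec a_i)_{i\in\omega}$ from $\mathbb M^p$ and every $\vec b\in\mathbb M^q$, there is $i_0\in\omega$ such that either $\mathbb M\models\psi(\vec a_i,\vec b)$ for all $i>i_0$ or $\mathbb M\models\neg\psi(\vec a_i,\vec b)$ for all $i>i_0$. -/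

import Mathlib

open FirstOrder

universe u v w

namespace PairNIP

/-! ### Dependent theories -/

section Dependent

variable {L : FirstOrder.Language.{u, v}}

/-- A sequence of `p`-tuples from `M` is indiscernible (over `∅`): any two finite subsequences of
the same length, taken in increasing order of the indices, satisfy the same formulas. -/
def Indiscernible (L : FirstOrder.Language.{u, v}) {M : Type w} [L.Structure M] {p : ℕ}
    (a : ℕ → Fin p → M) : Prop :=
  ∀ (k : ℕ) (φ : L.Formula (Fin k × Fin p)) (i j : Fin k → ℕ), StrictMono i → StrictMono j →
    (φ.Realize (fun s => a (i s.1) s.2) ↔ φ.Realize (fun s => a (j s.1) s.2))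

/-- The formula `φ(x, y)` is dependent in `T`: in every model of `T`, its truth value along an
indiscernible sequence, with any fixed parameters, is eventually constant. -/
def DependentFormula (T : L.Theory) {p q : ℕ} (φ : L.Formula (Fin p ⊕ Fin q)) : Prop :=
  ∀ (M : FirstOrder.Language.Theory.ModelType.{u, v, max u v} T) (a : ℕ → Fin p → M),
    Indiscernible L a → ∀ b : Fin q → M, ∃ i₀ : ℕ,
      (∀ i, i₀ < i → φ.Realize (Sum.elim (a i) b)) ∨
      (∀ i, i₀ < i → ¬ φ.Realize (Sum.elim (a i) b))

/-- The theory `T` is dependent (has NIP): every formula is dependent in `T`. -/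
def Dependent (T : L.Theory) : Prop :=
  ∀ (p q : ℕ) (φ : L.Formula (Fin p ⊕ Fin q)), DependentFormula T φ

end Dependent

/-! ### Intervals and o-minimality -/

/-- Open intervals of a linear order with endpoints in `M ∪ {-∞, +∞}`. -/
def IsOpenInterval {M : Type w} [LinearOrder M] (I : Set M) : Prop :=
  I = Set.univ ∨ (∃ b, I = Set.Iio b) ∨ (∃ a, I = Set.Ioi a) ∨ ∃ a b, I = Set.Ioo a b

/-- An ordered structure is o-minimal: every subset of `M` definable with parameters is a finite
union of open intervals and points. -/
def IsOMinimal (L : FirstOrder.Language.{u, v}) (M : Type w) [LinearOrder M] [L.Structure M] :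
    Prop :=
  ∀ D : Set M, Set.univ.Definable₁ L D →
    ∃ F : Set (Set M), F.Finite ∧ (∀ I ∈ F, IsOpenInterval I ∨ ∃ a, I = {a}) ∧ D = ⋃₀ F

/-! ### Pairs -/

/-- The relation symbols of the language `{U}`: one unary symbol `U`. -/
inductive PredRel : ℕ → Type
  | U : PredRel 1

/-- The language `{U}` with a single unary relation symbol. -/
def predLang : FirstOrder.Language.{0, 0} := ⟨fun _ => Empty, PredRel⟩

/-- The language `L(U) = L ∪ {U}`. -/
abbrev langU (L : FirstOrder.Language.{u, v}) : FirstOrder.Language.{u, v} := L.sum predLang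

/-- The `{U}`-structure on `M` in which `U` is interpreted as `N`. -/
@[reducible] def predStructure {M : Type w} (N : Set M) : predLang.Structure M where
  funMap := fun f _ => nomatch f
  RelMap := fun r x => match r, x with
    | PredRel.U, x => x 0 ∈ N

/-- The `L(U)`-structure `(M, N)`. -/
@[reducible] def pairStructure (L : FirstOrder.Language.{u, v}) {M : Type w} [L.Structure M]
    (N : Set M) : (langU L).Structure M :=
  letI := predStructure N
  FirstOrder.Language.sumStructure L predLang M

/-- The theory `T_N` of the pair `(M, N)` in the language `L(U)`. -/
def pairTheory (L : FirstOrder.Language.{u, v}) {M : Type w} [L.Structure M] (N : Set M) :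
    (langU L).Theory :=
  letI := pairStructure L N
  (langU L).completeTheory M

/-- The pair `(M, N)` is a model of the `L(U)`-theory `T`. -/
def IsPairModel {L : FirstOrder.Language.{u, v}} (T : (langU L).Theory) {M : Type w}
    [L.Structure M] (N : Set M) : Prop :=
  letI := pairStructure L N
  T.Model M

/-- `S ⊆ M ^ α` is definable in the pair `(M, N)` with parameters from `P`. -/
def PairDefinable (L : FirstOrder.Language.{u, v}) {M : Type w} [L.Structure M] (N : Set M)
    (P : Set M) {α : Type} (S : Set (α → M)) : Prop :=
  letI := pairStructure L N
  P.Definable (langU L) S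

/-- `D ⊆ M` is definable in the pair `(M, N)` with parameters from `M`. -/
def PairDefinable₁ (L : FirstOrder.Language.{u, v}) {M : Type w} [L.Structure M] (N : Set M)
    (D : Set M) : Prop :=
  PairDefinable L N Set.univ {x : Fin 1 → M | x 0 ∈ D}

/-- The subset of `M` defined in `(M, N)` by
`∃ y₁ ⋯ ∃ y_q, U(y₁) ∧ ⋯ ∧ U(y_q) ∧ φ(x, y₁, …, y_q)` for a quantifier-free `L`-formula `φ` with
parameters `c` from `M`. -/
def IsSpecialSet (L : FirstOrder.Language.{u, v}) {M : Type w} [L.Structure M] (N : Set M)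
    (E : Set M) : Prop :=
  ∃ (q r : ℕ) (φ : L.Formula (Fin 1 ⊕ (Fin q ⊕ Fin r))) (c : Fin r → M),
    FirstOrder.Language.BoundedFormula.IsQF φ ∧
      E = {x : M | ∃ y : Fin q → M, (∀ i, y i ∈ N) ∧
        φ.Realize (Sum.elim (fun _ => x) (Sum.elim y c))}

/-- Every subset of `N ^ n` definable in `(M, N)` is a boolean combination of sets `S ∩ K` with `S`
definable in `M` and `K` definable in `(M, N)` without parameters. -/
def CondTraces (L : FirstOrder.Language.{u, v}) {M : Type w} [L.Structure M] (N : Set M) : Prop :=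
  ∀ (n : ℕ) (D : Set (Fin n → M)), (∀ x ∈ D, ∀ i, x i ∈ N) →
    PairDefinable L N Set.univ D →
    D ∈ BooleanSubalgebra.closure {X : Set (Fin n → M) | ∃ S K : Set (Fin n → M),
      Set.univ.Definable L S ∧ PairDefinable L N ∅ K ∧ X = S ∩ K}

/-- Every subset of `M` definable in `(M, N)` is a boolean combination of special sets. -/
def CondSpecial (L : FirstOrder.Language.{u, v}) {M : Type w} [L.Structure M] (N : Set M) : Prop :=
  ∀ D : Set M, PairDefinable₁ L N D →
    D ∈ BooleanSubalgebra.closure {E : Set M | IsSpecialSet L N E}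

/-- Every subset of `M` which is open in the order topology and definable in `(M, N)` is a finite
union of open intervals. -/
def CondOpen (L : FirstOrder.Language.{u, v}) {M : Type w} [LinearOrder M] [L.Structure M]
    (N : Set M) : Prop :=
  ∀ D : Set M, PairDefinable₁ L N D → @IsOpen M (Preorder.topology M) D →
    ∃ F : Set (Set M), F.Finite ∧ (∀ I ∈ F, IsOpenInterval I) ∧ D = ⋃₀ F

end PairNIP

/-! The proof counts patterns. In a suitable model of the theory, the number of truth patterns that
single elements realize on `n` members of a definable family is polynomial in `n`
(`TamePair.polyGrowth`). Since `2 ^ k` outgrows every polynomial, no formula in one object variable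
is independent, and an indiscernible-sequence argument passes from one variable to several
(`eventuallyConstant_of_notIndependent`).

The count is done in a compact model elementarily equivalent to the given one
(`exists_compactStructure`), where pointwise finiteness becomes a uniform bound. Absence of `k`
independent tuples is first-order, so it returns to the original model.

For the reduct, o-minimality of `A` transfers only as local constancy of each definable family.
Together with (iii) this makes every `L`-definable set a finite union of convex sets. The pattern of
a point over such sets can be read off at the start of one of boundedly many definable upper sets
attached to one of them (`exists_germ`). This eliminates one coordinate, replacing a parameter `c
i'` by a pair `(c i, c i')`; induction gives `polyGrowth_reduct`. By (i) and compactness the bound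
extends to pair-definable relations on tuples from `N` (`polyGrowth_traces`).

By (ii) it remains to count for special sets, unions of sections `A(y, c)` over tuples `y` from `N`
(`polyGrowth_special`). The interiors unite to an open set, controlled by (iii). A remaining point
is one of boundedly many frontier points of some `A(y, c i)`, so it is coded by `y`, and counting
tuples from `N` suffices. -/

namespace PairNIP

/-! ### Alternation levels in a linear order -/

section Alternation

variable {M : Type w} [LinearOrder M]

/-- `altLevel X j` consists of the last elements of chains of length at least `j + 1` along which
membership in `X` alternates. -/
def altLevel (X : Set M) : ℕ → Set M
  | 0 => Set.univ
  | j + 1 => {s | ∃ s', s' ≤ s ∧ s' ∈ altLevel X j ∧ ¬(s' ∈ X ↔ s ∈ X)}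

theorem mem_altLevel_succ {X : Set M} {j : ℕ} {s : M} :
    s ∈ altLevel X (j + 1) ↔ ∃ s', s' ≤ s ∧ s' ∈ altLevel X j ∧ ¬(s' ∈ X ↔ s ∈ X) :=
  Iff.rfl

theorem altLevel_succ_subset (X : Set M) (j : ℕ) : altLevel X (j + 1) ⊆ altLevel X j := by
  induction j with
  | zero => exact fun _ _ => trivial
  | succ j ih =>
    rintro s ⟨s', hs, hj, hX⟩
    exact ⟨s', hs, ih hj, hX⟩

theorem altLevel_antitone (X : Set M) : Antitone (altLevel X) :=
  antitone_nat_of_succ_le (altLevel_succ_subset X)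

/-- Upper sets of a linear order are comparable, which lets levels of different sets be compared in
`exists_germ`. -/
theorem isUpperSet_altLevel (X : Set M) (j : ℕ) : IsUpperSet (altLevel X j) := by
  cases j with
  | zero => exact fun _ _ _ _ => trivial
  | succ j =>
    rintro s t hst ⟨s', hs, hj, hX⟩
    by_cases h : s ∈ X ↔ t ∈ X
    · exact ⟨s', hs.trans hst, hj, by rwa [← h]⟩
    · exact ⟨s, hst, altLevel_succ_subset X j ⟨s', hs, hj, hX⟩, h⟩

theorem mem_iff_mem_of_altLevel {X : Set M} {j : ℕ} {s x : M} (hsx : s ≤ x)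
    (hs : s ∈ altLevel X j) (hx : x ∉ altLevel X (j + 1)) : s ∈ X ↔ x ∈ X := by
  by_contra h
  exact hx ⟨s, hsx, hs, h⟩

theorem exists_altLevel {X : Set M} {k : ℕ} (hk : altLevel X k = ∅) (x : M) :
    ∃ j < k, x ∈ altLevel X j ∧ x ∉ altLevel X (j + 1) := by
  classical
  have hex : ∃ j, x ∉ altLevel X j := ⟨k, by simp [hk]⟩
  have h0 : Nat.find hex ≠ 0 := fun h => Nat.find_spec hex (by rw [h]; trivial)
  obtain ⟨j, hj⟩ := Nat.exists_eq_succ_of_ne_zero h0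
  refine ⟨j, ?_, ?_, ?_⟩
  · have := Nat.find_min' hex (m := k) (by simp [hk])
    omega
  · exact not_not.1 (Nat.find_min hex (m := j) (by omega))
  · simpa [hj] using Nat.find_spec hex

/-- The set `Y` contains an initial segment of the set `U`. -/
def Germ (U Y : Set M) : Prop :=
  ∃ t ∈ U, ∀ s ∈ U, s ≤ t → s ∈ Y

/-- For each `i` let `j i` be the exact level of `x` with respect to `X i`. Below `x`, inside the
smallest of these level sets, no `X i'` can change any more, so membership of `x` is already decided
at the beginning of that level set, a set that does not mention `x`. -/
theorem exists_germ {ι : Type*} [Finite ι] [Nonempty ι] (X : ι → Set M) {k : ℕ}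
    (hk : ∀ i, altLevel (X i) k = ∅) (x : M) :
    ∃ i, ∃ j < k, ∀ i', x ∈ X i' ↔ Germ (altLevel (X i) j) (X i') := by
  choose j hjk hj hj' using fun i => exists_altLevel (hk i) x
  obtain ⟨i, hi⟩ := Set.Finite.exists_minimalFor (fun i => altLevel (X i) (j i)) Set.univ
    Set.finite_univ Set.univ_nonempty
  have hmin : ∀ i', altLevel (X i) (j i) ⊆ altLevel (X i') (j i') := fun i' => by
    rcases (isUpperSet_altLevel (X i) (j i)).total (isUpperSet_altLevel (X i') (j i')) with h | h
    · exact h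
    · exact hi.2 (Set.mem_univ i') h
  have hconst : ∀ i', ∀ s ∈ altLevel (X i) (j i), s ≤ x → (s ∈ X i' ↔ x ∈ X i') :=
    fun i' s hs hsx => mem_iff_mem_of_altLevel hsx (hmin i' hs) (hj' i')
  refine ⟨i, j i, hjk i, fun i' => ⟨fun hx => ⟨x, hj i, fun s hs hsx => (hconst i' s hs hsx).2 hx⟩,
    ?_⟩⟩
  rintro ⟨t, ht, h⟩
  rcases le_total t x with htx | htx
  · exact (hconst i' t ht htx).1 (h t ht le_rfl)
  · exact h x (hj i) htx

/-- Each time an alternating chain enters the union it meets a member of `F` not met before, by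
convexity; hence at most `F.ncard` entries, each followed by at most one exit. -/
theorem altLevel_sUnion_eq_empty {F : Set (Set M)} (hF : F.Finite)
    (hconv : ∀ I ∈ F, I.OrdConnected) : altLevel (⋃₀ F) (2 * F.ncard + 2) = ∅ := by
  let cnt : M → ℕ := fun s => {I ∈ F | ∃ t ≤ s, t ∈ I}.ncard
  have hfin : ∀ s, {I ∈ F | ∃ t ≤ s, t ∈ I}.Finite := fun s => hF.subset (Set.sep_subset _ _)
  have hmono : ∀ {s s'}, s' ≤ s → cnt s' ≤ cnt s := fun {s s'} h =>
    Set.ncard_le_ncard (fun I hI => ⟨hI.1, hI.2.choose, hI.2.choose_spec.1.trans h,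
      hI.2.choose_spec.2⟩) (hfin s)
  have key : ∀ j s, s ∈ altLevel (⋃₀ F) j →
      (s ∈ ⋃₀ F → j ≤ 2 * cnt s) ∧ (s ∉ ⋃₀ F → j ≤ 2 * cnt s + 1) := by
    intro j
    induction j with
    | zero => intro s _; simp
    | succ j ih =>
      rintro s ⟨s', hs, hj, hX⟩
      have hm := hmono hs
      constructor
      · intro hsX
        have hs'X : s' ∉ ⋃₀ F := fun h => hX ⟨fun _ => hsX, fun _ => h⟩
        have h1 := (ih s' hj).2 hs'X
        obtain ⟨I, hIF, hsI⟩ := hsX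
        have : cnt s' < cnt s := by
          refine Set.ncard_lt_ncard ⟨fun J hJ => ⟨hJ.1, hJ.2.choose,
            hJ.2.choose_spec.1.trans hs, hJ.2.choose_spec.2⟩, fun h => ?_⟩ (hfin s)
          obtain ⟨-, t, hts, htI⟩ := h ⟨hIF, s, le_rfl, hsI⟩
          exact hs'X ⟨I, hIF, (hconv I hIF).out htI hsI ⟨hts, hs⟩⟩
        omega
      · intro hsX
        have hs'X : s' ∈ ⋃₀ F := by
          by_contra h
          exact hX ⟨fun h' => absurd h' h, fun h' => absurd h' hsX⟩
        have h1 := (ih s' hj).1 hs'X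
        omega
  refine Set.eq_empty_of_forall_notMem fun s hs => ?_
  have h1 : cnt s ≤ F.ncard := Set.ncard_le_ncard (Set.sep_subset _ _) hF
  have h2 := key _ s hs
  by_cases h : s ∈ ⋃₀ F
  · have := h2.1 h; omega
  · have := h2.2 h; omega

theorem altLevel_compl (X : Set M) (j : ℕ) : altLevel Xᶜ j = altLevel X j := by
  induction j with
  | zero => rfl
  | succ j ih => ext s; simp only [mem_altLevel_succ, ih, Set.mem_compl_iff, not_iff_not]

/-- A set with finitely many alternations is constant on a nonempty open interval inside every
nonempty open interval. -/
theorem exists_constant_Ioo {X : Set M} {k : ℕ} (hk : altLevel X k = ∅) {a b c : M} (hab : a < b)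
    (hbc : b < c) : ∃ u s v, a ≤ u ∧ u < s ∧ s < v ∧ v ≤ c ∧
      ∀ t t', u < t → t < v → u < t' → t' < v → (t ∈ X → t' ∈ X) := by
  -- A point of the highest level occurring between `a` and `c` has no alternation after it before
  -- `c`.
  have step : ∀ c, (∃ b, a < b ∧ b < c) → ∃ s, a < s ∧ s < c ∧
      ∀ t, s ≤ t → t < c → (s ∈ X ↔ t ∈ X) := by
    classical
    rintro c ⟨b, hab, hbc⟩
    obtain ⟨j, -, ⟨s, has, hsc, hsj⟩, hmax⟩ :
        ∃ j, True ∧ (∃ s, a < s ∧ s < c ∧ s ∈ altLevel X j) ∧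
          ∀ t, a < t → t < c → t ∉ altLevel X (j + 1) := by
      have hex : ∃ j, ∀ t, a < t → t < c → t ∉ altLevel X j := ⟨k, by simp [hk]⟩
      have h0 : Nat.find hex ≠ 0 := fun h =>
        Nat.find_spec hex b hab hbc (by rw [h]; trivial)
      obtain ⟨j, hj⟩ := Nat.exists_eq_succ_of_ne_zero h0
      refine ⟨j, trivial, ?_, ?_⟩
      · have := Nat.find_min hex (m := j) (by omega)
        push Not at this
        exact this
      · simpa [hj] using Nat.find_spec hex
    exact ⟨s, has, hsc, fun t hst htc =>
      mem_iff_mem_of_altLevel hst hsj (hmax t (has.trans_le hst) htc)⟩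
  obtain ⟨s, has, hsc, hs⟩ := step c ⟨b, hab, hbc⟩
  -- The order need not be dense: if `s` is the immediate predecessor of `c`, the search is repeated
  -- to the left of `s`, and where no room is left the interval found is `{s}`.
  by_cases h1 : ∃ s', s < s' ∧ s' < c
  · obtain ⟨s', hss', hs'c⟩ := h1
    exact ⟨s, s', c, has.le, hss', hs'c, le_rfl, fun t t' h1 h2 h3 h4 ht =>
      (hs t' h3.le h4).1 ((hs t h1.le h2).2 ht)⟩
  by_cases h2 : ∃ b, a < b ∧ b < s
  · obtain ⟨s1, has1, hs1s, hs1⟩ := step s h2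
    by_cases h3 : ∃ s', s1 < s' ∧ s' < s
    · obtain ⟨s', hss', hs'c⟩ := h3
      exact ⟨s1, s', s, has1.le, hss', hs'c, hsc.le, fun t t' h1 h2 h3 h4 ht =>
        (hs1 t' h3.le h4).1 ((hs1 t h1.le h2).2 ht)⟩
    · refine ⟨s1, s, c, has1.le, hs1s, hsc, le_rfl, fun t t' ht1 ht2 ht3 ht4 ht => ?_⟩
      have e : ∀ t, s1 < t → t < c → t = s := fun t ht ht' => by
        rcases lt_trichotomy t s with h | h | h
        · exact absurd ⟨t, ht, h⟩ h3
        · exact h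
        · exact absurd ⟨t, h, ht'⟩ h1
      rwa [e t' ht3 ht4, ← e t ht1 ht2]
  · refine ⟨a, s, c, le_rfl, has, hsc, le_rfl, fun t t' ht1 ht2 ht3 ht4 ht => ?_⟩
    have e : ∀ t, a < t → t < c → t = s := fun t ht ht' => by
      rcases lt_trichotomy t s with h | h | h
      · exact absurd ⟨t, ht, h⟩ h2
      · exact h
      · exact absurd ⟨t, h, ht'⟩ h1
    rwa [e t' ht3 ht4, ← e t ht1 ht2]

/-- A set with finitely many alternations which contains no nonempty open interval is finite. -/
theorem finite_of_altLevel {D : Set M} {k : ℕ} (hk : altLevel D k = ∅)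
    (hD : ∀ a b c, a < b → b < c → ∃ s, a < s ∧ s < c ∧ s ∉ D) : D.Finite := by
  choose lev hlev hmem hnot using exists_altLevel hk
  have hfib : ∀ j, {x ∈ D | lev x = j}.Finite := by
    intro j
    refine Set.not_infinite.1 fun hinf => ?_
    -- Three points of `D` of equal level enclose a nonempty interval, on which `D` would be
    -- constant; so each level holds at most two points of `D`.
    obtain ⟨T, hT, hcard⟩ := hinf.exists_subset_card_eq 3
    let e := T.orderEmbOfFin hcard
    have he : ∀ i, e i ∈ D ∧ lev (e i) = j := fun i => hT (T.orderEmbOfFin_mem hcard i)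
    obtain ⟨s, h0s, hs2, hsD⟩ := hD (e 0) (e 1) (e 2) (e.strictMono (by decide))
      (e.strictMono (by decide))
    refine hsD ((mem_iff_mem_of_altLevel hs2.le (j := j) ?_ ?_).2 (he 2).1)
    · exact isUpperSet_altLevel D j h0s.le ((he 0).2 ▸ hmem (e 0))
    · exact (he 2).2 ▸ hnot (e 2)
  refine ((Set.finite_Iio k).biUnion fun j _ => hfib j).subset fun x hx => ?_
  exact Set.mem_biUnion (hlev x) ⟨hx, rfl⟩

/-- The interior of `X` with respect to bounded open intervals. -/
def inner (X : Set M) : Set M :=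
  {x | ∃ u v, u < x ∧ x < v ∧ ∀ t, u < t → t < v → t ∈ X}

theorem inner_subset (X : Set M) : inner X ⊆ X := by
  rintro x ⟨u, v, hu, hv, h⟩
  exact h x hu hv

theorem isOpen_inner (X : Set M) : @IsOpen M (Preorder.topology M) (inner X) := by
  let := Preorder.topology M
  have : OrderTopology M := ⟨rfl⟩
  refine isOpen_iff_forall_mem_open.2 ?_
  rintro x ⟨u, v, hu, hv, h⟩
  exact ⟨Set.Ioo u v, fun y hy => ⟨u, v, hy.1, hy.2, h⟩, isOpen_Ioo, hu, hv⟩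

/-- The elements of `D` with at least `j` elements of `D` below them. -/
def rankLevel (D : Set M) : ℕ → Set M
  | 0 => D
  | j + 1 => {s | s ∈ D ∧ ∃ s', s' < s ∧ s' ∈ rankLevel D j}

theorem rankLevel_subset (D : Set M) (j : ℕ) : rankLevel D j ⊆ D := by
  cases j with
  | zero => exact subset_rfl
  | succ j => exact fun s hs => hs.1

theorem rankLevel_succ_subset (D : Set M) (j : ℕ) : rankLevel D (j + 1) ⊆ rankLevel D j := by
  induction j with
  | zero => exact rankLevel_subset D 1
  | succ j ih =>
    rintro s ⟨hs, s', hs', h⟩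
    exact ⟨hs, s', hs', ih h⟩

theorem rankLevel_antitone (D : Set M) : Antitone (rankLevel D) :=
  antitone_nat_of_succ_le (rankLevel_succ_subset D)

theorem rankLevel_unique {D : Set M} {j : ℕ} {s t : M} (hs : s ∈ rankLevel D j)
    (hs' : s ∉ rankLevel D (j + 1)) (ht : t ∈ rankLevel D j) (ht' : t ∉ rankLevel D (j + 1)) :
    s = t := by
  rcases lt_trichotomy s t with h | h | h
  · exact absurd ⟨rankLevel_subset D j ht, s, h, hs⟩ ht'
  · exact h
  · exact absurd ⟨rankLevel_subset D j hs, t, h, ht⟩ hs'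

theorem exists_rankLevel {D : Set M} {k : ℕ} (hk : rankLevel D k = ∅) {x : M} (hx : x ∈ D) :
    ∃ j < k, x ∈ rankLevel D j ∧ x ∉ rankLevel D (j + 1) := by
  classical
  have hex : ∃ j, x ∉ rankLevel D j := ⟨k, by simp [hk]⟩
  have h0 : Nat.find hex ≠ 0 := fun h => Nat.find_spec hex (by rw [h]; exact hx)
  obtain ⟨j, hj⟩ := Nat.exists_eq_succ_of_ne_zero h0
  refine ⟨j, ?_, ?_, ?_⟩
  · have := Nat.find_min' hex (m := k) (by simp [hk])
    omega
  · exact not_not.1 (Nat.find_min hex (m := j) (by omega))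
  · simpa [hj] using Nat.find_spec hex

theorem rankLevel_ncard_eq_empty {D : Set M} (hD : D.Finite) : rankLevel D D.ncard = ∅ := by
  have key : ∀ j, ∀ s ∈ rankLevel D j, j + 1 ≤ {x ∈ D | x ≤ s}.ncard := by
    intro j
    induction j with
    | zero =>
      intro s hs
      exact (Set.ncard_pos (hD.subset (Set.sep_subset _ _))).2 ⟨s, hs, le_rfl⟩
    | succ j ih =>
      rintro s ⟨hs, s', hs', h⟩
      have h1 := ih s' h
      have h2 : {x ∈ D | x ≤ s'}.ncard < {x ∈ D | x ≤ s}.ncard :=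
        Set.ncard_lt_ncard ⟨fun x hx => ⟨hx.1, hx.2.trans hs'.le⟩,
          fun h => not_le.2 hs' (h ⟨hs, le_rfl⟩).2⟩ (hD.subset (Set.sep_subset _ _))
      omega
  refine Set.eq_empty_of_forall_notMem fun s hs => ?_
  have h1 := key _ s hs
  have h2 : {x ∈ D | x ≤ s}.ncard ≤ D.ncard := Set.ncard_le_ncard (Set.sep_subset _ _) hD
  omega

end Alternation

/-! ### Polynomial growth of the number of patterns -/

section Growth

variable {X X' C C' : Type*}

/-- The patterns `i ↦ R x (c i)` realized by elements `x` of `Y`. -/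
def patterns (Y : Set X) (R : X → C → Prop) {n : ℕ} (c : Fin n → C) : Set (Fin n → Prop) :=
  (fun x i => R x (c i)) '' Y

/-- The number of patterns over `n` parameters realized in `Y` is bounded by a polynomial. -/
def PolyGrowth (Y : Set X) (R : X → C → Prop) : Prop :=
  ∃ K d : ℕ, ∀ (n : ℕ) (c : Fin n → C), (patterns Y R c).ncard ≤ K * (n + 1) ^ d

theorem PolyGrowth.comp_param {Y : Set X} {R : X → C → Prop} (h : PolyGrowth Y R) (f : C' → C) :
    PolyGrowth Y (fun x c => R x (f c)) := by
  obtain ⟨K, d, h⟩ := h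
  exact ⟨K, d, fun n c => h n (f ∘ c)⟩

theorem PolyGrowth.comp_point {Y : Set X} {R : X → C → Prop} (h : PolyGrowth Y R) {Y' : Set X'}
    {f : X' → X} (hf : Set.MapsTo f Y' Y) : PolyGrowth Y' (fun x c => R (f x) c) := by
  obtain ⟨K, d, h⟩ := h
  refine ⟨K, d, fun n c => (Set.ncard_le_ncard ?_ (Set.toFinite _)).trans (h n c)⟩
  rintro _ ⟨x, hx, rfl⟩
  exact ⟨f x, hf hx, rfl⟩

theorem PolyGrowth.of_subsingleton [Subsingleton X] (Y : Set X) (R : X → C → Prop) :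
    PolyGrowth Y R :=
  ⟨1, 0, fun _ _ => by
    rw [pow_zero, mul_one, Set.ncard_le_one_iff_subsingleton]
    exact (Set.subsingleton_of_subsingleton (s := Y)).image _⟩

/-- If membership in the sets of one family is determined by membership in finitely many sets from
families of polynomial growth, then the family has polynomial growth. -/
theorem PolyGrowth.of_determined {ι : Type*} [Finite ι] {P : ι → Type*} {Y : Set X}
    {R : X → C → Prop} {Q : ∀ j, X → P j → Prop} (hQ : ∀ j, PolyGrowth Y (Q j))
    (hR : ∀ c, ∃ e : ∀ j, P j, ∀ x ∈ Y, ∀ x' ∈ Y, (∀ j, Q j x (e j) ↔ Q j x' (e j)) →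
      R x c → R x' c) : PolyGrowth Y R := by
  classical
  cases nonempty_fintype ι
  choose e he using hR
  choose K d hKd using hQ
  refine ⟨∏ j, K j, ∑ j, d j, fun n c => ?_⟩
  -- The pattern of `R` is a function of the tuple of patterns of the `Q j`, so the product of their
  -- bounds applies.
  let B : Set (∀ _ : ι, Fin n → Prop) :=
    Set.univ.pi fun j => patterns Y (Q j) fun i => e (c i) j
  let F : X → ι → Fin n → Prop := fun x j i => Q j x (e (c i) j)
  have hex : ∀ f : ι → Fin n → Prop, ∃ g : Fin n → Prop,
      ∀ x ∈ Y, F x = f → (fun i => R x (c i)) = g := by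
    intro f
    by_cases h : ∃ x ∈ Y, F x = f
    · obtain ⟨x, hx, hxf⟩ := h
      refine ⟨fun i => R x (c i), fun x' hx' hf => ?_⟩
      · have hFF : ∀ i j, Q j x (e (c i) j) ↔ Q j x' (e (c i) j) := fun i j =>
          iff_of_eq (congr_fun (congr_fun (hxf.trans hf.symm) j) i)
        funext i
        exact propext ⟨he (c i) x' hx' x hx fun j => (hFF i j).symm,
          he (c i) x hx x' hx' (hFF i)⟩
    · exact ⟨fun _ => True, fun x hx hf => absurd ⟨x, hx, hf⟩ h⟩
  choose G hG using hex
  have hsub : patterns Y R c ⊆ G '' B := by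
    rintro _ ⟨x, hx, rfl⟩
    exact ⟨F x, fun j _ => ⟨x, hx, rfl⟩, (hG (F x) x hx rfl).symm⟩
  calc (patterns Y R c).ncard ≤ (G '' B).ncard := Set.ncard_le_ncard hsub (Set.toFinite _)
    _ ≤ B.ncard := Set.ncard_image_le (Set.toFinite _)
    _ = ∏ j, (patterns Y (Q j) fun i => e (c i) j).ncard := by
        have := Set.toFinite B
        simp only [B, Set.ncard_eq_toFinset_card', ← Fintype.card_piFinset]
        congr 1
        ext f
        simp
    _ ≤ ∏ j, K j * (n + 1) ^ d j := Finset.prod_le_prod' fun j _ => hKd j n _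
    _ = _ := by rw [Finset.prod_mul_distrib, Finset.prod_pow_eq_pow_sum]

theorem PolyGrowth.const (Y : Set X) (κ : X → Prop) : PolyGrowth Y (fun x (_ : C) => κ x) := by
  refine ⟨2, 0, fun n c => ?_⟩
  have : patterns Y (fun x (_ : C) => κ x) c ⊆ {fun _ => True, fun _ => False} := by
    rintro _ ⟨x, -, rfl⟩
    by_cases h : κ x <;> simp [h]
  calc _ ≤ _ := Set.ncard_le_ncard this (Set.toFinite _)
    _ ≤ _ := by simpa using Set.ncard_insert_le (fun _ : Fin n => True) {fun _ => False}

theorem PolyGrowth.and {Y : Set X} {R : X → C → Prop} {S : X → C' → Prop} (hR : PolyGrowth Y R)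
    (hS : PolyGrowth Y S) : PolyGrowth Y (fun x (c : C × C') => R x c.1 ∧ S x c.2) := by
  refine PolyGrowth.of_determined (ι := Bool) (P := fun _ => C × C')
    (Q := fun j => bif j then fun x c => R x c.1 else fun x c => S x c.2)
    (by rintro (_ | _); exacts [hS.comp_param Prod.snd, hR.comp_param Prod.fst])
    fun c => ⟨fun _ => c, fun x _ x' _ h hx => ⟨(h true).1 hx.1, (h false).1 hx.2⟩⟩

theorem PolyGrowth.or {Y : Set X} {R S : X → C → Prop} (hR : PolyGrowth Y R)
    (hS : PolyGrowth Y S) : PolyGrowth Y (fun x c => R x c ∨ S x c) := by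
  refine PolyGrowth.of_determined (ι := Bool) (P := fun _ => C)
    (Q := fun j => bif j then R else S) (by rintro (_ | _) <;> assumption)
    fun c => ⟨fun _ => c, fun x _ x' _ h hx => hx.imp (h true).1 (h false).1⟩

/-- If every nonempty pattern over `c₁, …, cₙ` coincides with a pattern over
`(cᵢ, c₁), …, (cᵢ, cₙ)`, for some `i`, of one of finitely many families of polynomial growth, then
the family has polynomial growth. -/
theorem PolyGrowth.of_branching {ι : Type*} [Finite ι] {Y : Set X} {Y' : Set X'}
    {R : X → C → Prop} {Q : ι → X' → C × C → Prop} (hQ : ∀ j, PolyGrowth Y' (Q j))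
    (hR : ∀ (n : ℕ) (c : Fin (n + 1) → C), ∀ x ∈ Y, (∀ i', ¬R x (c i')) ∨
      ∃ i j, ∃ x' ∈ Y', ∀ i', R x (c i') ↔ Q j x' (c i, c i')) : PolyGrowth Y R := by
  classical
  cases nonempty_fintype ι
  choose K d hKd using hQ
  refine ⟨∑ j, K j + 1, ∑ j, d j + 1, fun n c => ?_⟩
  cases n with
  | zero =>
    have h1 : (patterns Y R c).ncard ≤ 1 :=
      Set.ncard_le_one_iff_subsingleton.2 Set.subsingleton_of_subsingleton
    simpa using h1.trans (Nat.le_add_left 1 _)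
  | succ n =>
    -- One pattern for the all-false case, and for each pair `(i, j)` a polynomial number.
    have hsub : patterns Y R c ⊆ insert (fun _ => False)
        (⋃ p ∈ (Finset.univ : Finset (Fin (n + 1) × ι)),
          patterns Y' (Q p.2) fun i' => (c p.1, c i')) := by
      rintro _ ⟨x, hx, rfl⟩
      rcases hR n c x hx with h | ⟨i, j, x', hx', h⟩
      · exact .inl (funext fun i' => eq_false (h i'))
      · refine .inr ?_
        simp only [Set.mem_iUnion]
        exact ⟨(i, j), Finset.mem_univ _, x', hx', funext fun i' => propext (h i').symm⟩
    have hd : ∀ j, d j ≤ ∑ j, d j := fun j =>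
      Finset.single_le_sum (fun _ _ => Nat.zero_le _) (Finset.mem_univ j)
    calc (patterns Y R c).ncard ≤ _ := Set.ncard_le_ncard hsub (Set.toFinite _)
      _ ≤ _ := Set.ncard_insert_le _ _
      _ ≤ ∑ p : Fin (n + 1) × ι, (patterns Y' (Q p.2) fun i' => (c p.1, c i')).ncard + 1 :=
          Nat.add_le_add_right (Finset.set_ncard_biUnion_le _ _) 1
      _ ≤ ∑ p : Fin (n + 1) × ι, K p.2 * (n + 1 + 1) ^ ∑ j, d j + 1 :=
          Nat.add_le_add_right (Finset.sum_le_sum fun p _ => (hKd p.2 _ _).trans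
            (Nat.mul_le_mul_left _ (Nat.pow_le_pow_right (by omega) (hd _)))) 1
      _ = (n + 1) * ((∑ j, K j) * (n + 1 + 1) ^ ∑ j, d j) + 1 := by
          rw [Fintype.sum_prod_type]
          simp [Finset.sum_mul]
      _ ≤ (n + 1 + 1) * ((∑ j, K j) * (n + 1 + 1) ^ ∑ j, d j) +
            (n + 1 + 1) * (n + 1 + 1) ^ ∑ j, d j := by
          gcongr
          · omega
          · exact Nat.mul_pos (by omega) (by positivity)
      _ = _ := by ring

/-- In a family of polynomial growth, large subfamilies are not independent. -/
theorem PolyGrowth.exists_not_independent {R : X → C → Prop} (h : PolyGrowth Set.univ R) :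
    ∃ k : ℕ, ∀ c : Fin k → C, ¬∀ η : Fin k → Prop, ∃ x, ∀ i, R x (c i) ↔ η i := by
  obtain ⟨K, d, h⟩ := h
  have hlim : Filter.Tendsto (fun n : ℕ => (n : ℝ) ^ d / 2 ^ n) Filter.atTop (nhds 0) :=
    tendsto_pow_const_div_const_pow_of_one_lt d one_lt_two
  obtain ⟨k, hk⟩ : ∃ k : ℕ, K * (k + 1) ^ d < 2 ^ k := by
    -- The limit is used at exponent `k + 1`; the factor `2` in `2 * K + 1` pays for passing from `2
    -- ^ (k + 1)` to `2 ^ k`.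
    have h2 : (0 : ℝ) < 1 / (2 * K + 1) := by positivity
    obtain ⟨n, hn, hn1⟩ := ((hlim.eventually (gt_mem_nhds h2)).and
      (Filter.eventually_ge_atTop 1)).exists
    obtain ⟨k, rfl⟩ := Nat.exists_eq_add_of_le' hn1
    refine ⟨k, ?_⟩
    rw [div_lt_div_iff₀ (by positivity) (by positivity)] at hn
    have h3 : (0 : ℝ) < ((k + 1 : ℕ) : ℝ) ^ d := by positivity
    have : (K : ℝ) * ((k + 1 : ℕ) : ℝ) ^ d < 2 ^ k := by
      rw [pow_succ] at hn
      nlinarith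
    exact_mod_cast this
  refine ⟨k, fun c hc => ?_⟩
  have huniv : patterns Set.univ R c = Set.univ := by
    refine Set.eq_univ_of_forall fun η => ?_
    obtain ⟨x, hx⟩ := hc η
    exact ⟨x, trivial, funext fun i => propext (hx i)⟩
  have := h k c
  rw [huniv, Set.ncard_univ, Nat.card_eq_fintype_card] at this
  simp only [Fintype.card_pi, Fintype.card_prop, Finset.prod_const, Finset.card_univ,
    Fintype.card_fin] at this
  omega

end Growth

open FirstOrder.Language

/-! ### Definable predicates -/

section DefP

variable {L : FirstOrder.Language.{u, v}} {M : Type w} [L.Structure M] {α β : Type}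

/-- The predicate `P` on `α`-tuples is definable without parameters. -/
def DefP (L : FirstOrder.Language.{u, v}) {M : Type w} [L.Structure M] {α : Type}
    (P : (α → M) → Prop) : Prop :=
  ∃ φ : L.Formula α, ∀ v, φ.Realize v ↔ P v

theorem DefP.reindex {P : (α → M) → Prop} (h : DefP L P) (f : α → β) :
    DefP L fun w : β → M => P fun i => w (f i) := by
  obtain ⟨φ, hφ⟩ := h
  exact ⟨φ.relabel f, fun w => by rw [Formula.realize_relabel, hφ]; rfl⟩

theorem DefP.not {P : (α → M) → Prop} (h : DefP L P) : DefP L fun w => ¬P w := by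
  obtain ⟨φ, hφ⟩ := h
  exact ⟨φ.not, fun w => by rw [Formula.realize_not, hφ]⟩

theorem DefP.and {P Q : (α → M) → Prop} (h : DefP L P) (h' : DefP L Q) :
    DefP L fun w => P w ∧ Q w := by
  obtain ⟨φ, hφ⟩ := h
  obtain ⟨ψ, hψ⟩ := h'
  exact ⟨φ ⊓ ψ, fun w => by rw [Formula.realize_inf, hφ, hψ]⟩

theorem DefP.congr {P Q : (α → M) → Prop} (h : DefP L P) (hPQ : ∀ v, P v ↔ Q v) : DefP L Q := by
  obtain ⟨φ, hφ⟩ := h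
  exact ⟨φ, fun v => (hφ v).trans (hPQ v)⟩

theorem DefP.imp {P Q : (α → M) → Prop} (h : DefP L P) (h' : DefP L Q) :
    DefP L fun w => P w → Q w :=
  (h.and h'.not).not.congr fun _ => by tauto

theorem DefP.or {P Q : (α → M) → Prop} (h : DefP L P) (h' : DefP L Q) :
    DefP L fun w => P w ∨ Q w :=
  (h.not.and h'.not).not.congr fun _ => by tauto

theorem DefP.iff {P Q : (α → M) → Prop} (h : DefP L P) (h' : DefP L Q) :
    DefP L fun w => (P w ↔ Q w) :=
  ((h.imp h').and (h'.imp h)).congr fun _ => iff_def.symm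

theorem DefP.const (p : Prop) : DefP L fun _ : α → M => p := by
  by_cases hp : p
  · exact ⟨⊤, fun v => by simp [hp]⟩
  · exact ⟨⊥, fun v => by simp [hp]⟩

theorem DefP.forall_index {ι : Type*} [Finite ι] {P : ι → (α → M) → Prop}
    (h : ∀ i, DefP L (P i)) : DefP L fun w => ∀ i, P i w := by
  choose φ hφ using h
  exact ⟨Formula.iInf φ, fun w => by simp [hφ]⟩

theorem DefP.ex {P : (α → M) → (β → M) → Prop} [Finite β]
    (h : DefP L fun w : α ⊕ β → M => P (fun i => w (.inl i)) (fun j => w (.inr j))) :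
    DefP L fun w => ∃ u, P w u := by
  obtain ⟨φ, hφ⟩ := h
  exact ⟨φ.iExs β, fun w => by simp [hφ]⟩

theorem DefP.all {P : (α → M) → (β → M) → Prop} [Finite β]
    (h : DefP L fun w : α ⊕ β → M => P (fun i => w (.inl i)) (fun j => w (.inr j))) :
    DefP L fun w => ∀ u, P w u :=
  (DefP.ex (P := fun w u => ¬P w u) h.not).not.congr fun _ => by push Not; rfl

theorem DefP.ex₁ {P : (α → M) → M → Prop}
    (h : DefP L fun w : Option α → M => P (fun i => w (some i)) (w none)) :
    DefP L fun w => ∃ t, P w t := by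
  have := DefP.ex (P := fun w u => P w (u ())) (β := Unit) (L := L) (M := M)
    (h.reindex fun o => o.elim (Sum.inr ()) Sum.inl)
  exact this.congr fun w => ⟨fun ⟨u, hu⟩ => ⟨u (), hu⟩, fun ⟨t, ht⟩ => ⟨fun _ => t, ht⟩⟩

theorem DefP.all₁ {P : (α → M) → M → Prop}
    (h : DefP L fun w : Option α → M => P (fun i => w (some i)) (w none)) :
    DefP L fun w => ∀ t, P w t :=
  (DefP.ex₁ (P := fun w t => ¬P w t) h.not).not.congr fun _ => by push Not; rfl

theorem DefP.definable {P : (α ⊕ β → M) → Prop} (h : DefP L P) (c : β → M) :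
    Set.univ.Definable L {x : α → M | P (Sum.elim x c)} := by
  obtain ⟨φ, hφ⟩ := h
  refine Set.definable_iff_exists_formula_sum.2
    ⟨φ.relabel (Sum.elim .inr fun j => .inl ⟨c j, trivial⟩), ?_⟩
  ext x
  simp only [Set.mem_ofPred_eq, Formula.realize_relabel, hφ]
  refine iff_of_eq (congr_arg P ?_)
  funext i
  cases i <;> rfl

theorem exists_defP_of_definable {S : Set (α → M)} (h : Set.univ.Definable L S) :
    ∃ (r : ℕ) (φ : L.Formula (α ⊕ Fin r)) (e : Fin r → M),
      ∀ x, x ∈ S ↔ φ.Realize (Sum.elim x e) := by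
  obtain ⟨A, -, hA⟩ := Set.definable_iff_finitely_definable.1 h
  obtain ⟨φ, rfl⟩ := Set.definable_iff_exists_formula_sum.1 hA
  obtain ⟨r, ⟨f⟩⟩ := Finite.exists_equiv_fin (A : Set M)
  refine ⟨r, φ.relabel (Sum.elim (fun a => .inr (f a)) .inl), fun j => (f.symm j : M),
    fun x => ?_⟩
  simp only [Set.mem_ofPred_eq, Formula.realize_relabel]
  refine iff_of_eq (congr_arg φ.Realize ?_)
  funext i
  cases i <;> simp

theorem exists_formula_of_definable_empty {S : Set (α → M)} (h : (∅ : Set M).Definable L S) :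
    ∃ φ : L.Formula α, ∀ x, x ∈ S ↔ φ.Realize x := by
  obtain ⟨φ, rfl⟩ := Set.empty_definable_iff.1 h
  exact ⟨φ, fun x => Iff.rfl⟩

/-- `R` is a relation between tuples which is definable without parameters. -/
def DefRel (L : FirstOrder.Language.{u, v}) {M : Type w} [L.Structure M] {α β : Type}
    (R : (α → M) → (β → M) → Prop) : Prop :=
  ∀ (γ : Type) (f : α → γ) (g : β → γ),
    DefP L fun w : γ → M => R (fun i => w (f i)) fun j => w (g j)

/-- Definability in generic variables gives every substitution instance, including those with
repeated variables. -/
theorem DefRel.of_defP {R : (α → M) → (β → M) → Prop}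
    (h : DefP L fun w : α ⊕ β → M => R (fun i => w (.inl i)) fun j => w (.inr j)) : DefRel L R :=
  fun _ f g => h.reindex (Sum.elim f g)

theorem DefRel.of_formula (φ : L.Formula (α ⊕ β)) :
    DefRel L fun (x : α → M) (c : β → M) => φ.Realize (Sum.elim x c) :=
  .of_defP ⟨φ, fun _ => iff_of_eq (congr_arg φ.Realize (Sum.elim_comp_inl_inr _).symm)⟩

/-- `X` is a family of subsets of `M`, definable uniformly in the parameters. -/
def DefFamily (L : FirstOrder.Language.{u, v}) {M : Type w} [L.Structure M] {β : Type}
    (X : (β → M) → Set M) : Prop :=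
  ∀ (γ : Type) (a : γ) (f : β → γ), DefP L fun w : γ → M => w a ∈ X fun j => w (f j)

theorem DefFamily.of_defP {X : (β → M) → Set M}
    (h : DefP L fun w : Option β → M => w none ∈ X fun j => w (some j)) : DefFamily L X :=
  fun _ a f => h.reindex fun o => o.elim a f

theorem DefFamily.compl {X : (β → M) → Set M} (hX : DefFamily L X) :
    DefFamily L fun c => (X c)ᶜ :=
  fun γ a f => (hX γ a f).not

theorem DefFamily.union {X Y : (β → M) → Set M} (hX : DefFamily L X) (hY : DefFamily L Y) :
    DefFamily L fun c => X c ∪ Y c :=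
  fun γ a f => (hX γ a f).or (hY γ a f)

theorem DefFamily.eq_empty {X : (β → M) → Set M} (hX : DefFamily L X) :
    DefP L fun c : β → M => X c = ∅ := by
  have : DefP L fun c : β → M => ¬∃ t, t ∈ X c := .not (.ex₁ (hX _ _ _))
  exact this.congr fun c => by rw [← Set.Nonempty, Set.not_nonempty_iff_eq_empty]

end DefP

/-! ### Structures which are compact for definable covers -/

section Compact

variable {L : FirstOrder.Language.{u, v}} {M : Type w} [L.Structure M] {α β : Type}

/-- Every cover of a power of `M` by sets definable without parameters has a finite subcover;
equivalently, `M` realizes all types over `∅` which are finitely satisfiable in `M`. -/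
def CompactStructure (L : FirstOrder.Language.{u, v}) (M : Type w) [L.Structure M] : Prop :=
  ∀ (r : ℕ) (Φ : Set (L.Formula (Fin r))), (∀ c : Fin r → M, ∃ φ ∈ Φ, φ.Realize c) →
    ∃ Φ₀ ⊆ Φ, Φ₀.Finite ∧ ∀ c : Fin r → M, ∃ φ ∈ Φ₀, φ.Realize c

theorem CompactStructure.finite_subcover (hM : CompactStructure L M) {ι : Type*} [Finite β]
    {P : ι → (β → M) → Prop} (hP : ∀ i, DefP L (P i)) (hcov : ∀ c, ∃ i, P i c) :
    ∃ S : Set ι, S.Finite ∧ ∀ c, ∃ i ∈ S, P i c := by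
  obtain ⟨r, ⟨e⟩⟩ := Finite.exists_equiv_fin β
  choose φ hφ using hP
  obtain ⟨Φ₀, hsub, hfin, hΦ⟩ := hM r (Set.range fun i => (φ i).relabel e) fun c => by
    obtain ⟨i, hi⟩ := hcov fun b => c (e b)
    exact ⟨_, ⟨i, rfl⟩, by rw [Formula.realize_relabel, hφ]; exact hi⟩
  choose g hg using fun φ (h : φ ∈ Φ₀) => hsub h
  have := hfin.to_subtype
  refine ⟨Set.range fun φ : Φ₀ => g φ φ.2, Set.finite_range _, fun c => ?_⟩
  obtain ⟨ψ, hψ, h⟩ := hΦ fun j => c (e.symm j)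
  refine ⟨g ψ hψ, ⟨⟨ψ, hψ⟩, rfl⟩, ?_⟩
  rw [← hg ψ hψ, Formula.realize_relabel, hφ] at h
  simpa [Function.comp_def] using h

/-- By monotonicity, the largest index in a finite subcover works everywhere. This turns finiteness
of each member of a family into a common bound. -/
theorem CompactStructure.uniform_bound (hM : CompactStructure L M) [Finite β]
    {P : ℕ → (β → M) → Prop} (hP : ∀ i, DefP L (P i)) (hmono : ∀ c, Monotone fun i => P i c)
    (hcov : ∀ c, ∃ i, P i c) : ∃ k, ∀ c, P k c := by
  obtain ⟨S, hS, h⟩ := hM.finite_subcover hP hcov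
  obtain ⟨k, hk⟩ := hS.bddAbove
  refine ⟨k, fun c => ?_⟩
  obtain ⟨i, hi, hc⟩ := h c
  exact hmono c (hk hi) hc

/-- If each set in a definable family is determined by finitely many sets from families of
polynomial growth, then the family has polynomial growth. -/
theorem CompactStructure.polyGrowth_of_determined (hM : CompactStructure L M) [Nonempty M]
    [Finite α] [Finite β] {Γ : Type*} {r : Γ → ℕ} {Q : ∀ g, (α → M) → (Fin (r g) → M) → Prop}
    (hQ : ∀ g, DefRel L (Q g)) {Y : Set (α → M)} (hY : DefP L fun x => x ∈ Y)
    {R : (α → M) → (β → M) → Prop} (hR : DefRel L R)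
    (hQY : ∀ g, PolyGrowth Y (Q g))
    (hdet : ∀ c, ∃ (m : ℕ) (g : Fin m → Γ) (e : ∀ j, Fin (r (g j)) → M), ∀ x ∈ Y, ∀ x' ∈ Y,
      (∀ j, Q (g j) x (e j) ↔ Q (g j) x' (e j)) → R x c → R x' c) : PolyGrowth Y R := by
  -- `P s` says that the finite list `s` of families determines `R`'s section at `c` for some choice
  -- of parameters. This is definable, so finitely many lists serve all `c`.
  let P : (Σ m : ℕ, Fin m → Γ) → (β → M) → Prop := fun s c =>
    ∃ e : (Σ j, Fin (r (s.2 j))) → M, ∀ x : α → M, x ∈ Y → ∀ x' : α → M, x' ∈ Y →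
      (∀ j, Q (s.2 j) x (fun i => e ⟨j, i⟩) ↔ Q (s.2 j) x' (fun i => e ⟨j, i⟩)) →
        R x c → R x' c
  have hP : ∀ s, DefP L (P s) := by
    intro s
    refine .ex (.all (.imp ?_ (.all (.imp ?_ (.imp (.forall_index fun j => .iff ?_ ?_)
      (.imp ?_ ?_))))))
    · exact hY.reindex Sum.inr
    · exact hY.reindex Sum.inr
    · exact hQ _ _ _ _
    · exact hQ _ _ _ _
    · exact hR _ _ _
    · exact hR _ _ _
  obtain ⟨S, hS, hcov⟩ := hM.finite_subcover hP fun c => by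
    obtain ⟨m, g, e, h⟩ := hdet c
    exact ⟨⟨m, g⟩, fun p => e p.1 p.2, h⟩
  have := hS.to_subtype
  refine PolyGrowth.of_determined (ι := Σ s : S, Fin s.1.1)
    (P := fun p => Fin (r (p.1.1.2 p.2)) → M) (Q := fun p => Q (p.1.1.2 p.2))
    (fun p => hQY _) fun c => ?_
  obtain ⟨s, hs, e, he⟩ := hcov c
  classical
  -- All lists of the finite subcover are used at once; those other than the list chosen for `c` get
  -- arbitrary parameters.
  refine ⟨fun p => if h : p.1.1 = s then fun i => e ⟨h ▸ p.2, Fin.cast (by subst h; rfl) i⟩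
    else fun _ => Classical.arbitrary M, fun x hx x' hx' h => he x hx x' hx' fun j => ?_⟩
  simpa using h ⟨⟨s, hs⟩, j⟩

end Compact

/-! ### Definability of levels -/

section Levels

variable {L : FirstOrder.Language.{u, v}} {M : Type w} [L.Structure M] [LinearOrder M] {β : Type}

/-- The order of `M` is definable without parameters. -/
def OrderDefP (L : FirstOrder.Language.{u, v}) (M : Type w) [L.Structure M] [LinearOrder M] :
    Prop :=
  ∀ (γ : Type) (a b : γ), DefP L fun w : γ → M => w a ≤ w b

theorem OrderDefP.lt (hle : OrderDefP L M) (γ : Type) (a b : γ) :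
    DefP L fun w : γ → M => w a < w b :=
  (hle γ b a).not.congr fun _ => not_le

theorem DefFamily.altLevel (hle : OrderDefP L M) {X : (β → M) → Set M} (hX : DefFamily L X)
    (j : ℕ) : DefFamily L fun c => altLevel (X c) j := by
  induction j with
  | zero => exact fun γ a f => .const True
  | succ j ih =>
    intro γ a f
    refine .ex₁ (.and ?_ (.and ?_ (.not (.iff ?_ ?_))))
    · exact hle _ _ _
    · exact ih _ _ _
    · exact hX _ _ _
    · exact hX _ _ _

theorem DefFamily.rankLevel (hle : OrderDefP L M) {X : (β → M) → Set M} (hX : DefFamily L X)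
    (j : ℕ) : DefFamily L fun c => rankLevel (X c) j := by
  induction j with
  | zero => exact hX
  | succ j ih =>
    intro γ a f
    refine .and (hX _ _ _) (.ex₁ (.and ?_ ?_))
    · exact hle.lt _ _ _
    · exact ih _ _ _

theorem DefFamily.inner (hle : OrderDefP L M) {X : (β → M) → Set M} (hX : DefFamily L X) :
    DefFamily L fun c => inner (X c) := by
  intro γ a f
  refine .ex₁ (.ex₁ (.and ?_ (.and ?_ (.all₁ (.imp ?_ (.imp ?_ ?_))))))
  · exact hle.lt _ _ _
  · exact hle.lt _ _ _
  · exact hle.lt _ _ _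
  · exact hle.lt _ _ _
  · exact hX _ _ _

/-- The germ of one member of a definable family along a level of another one. -/
theorem DefFamily.germ {α : Type} (hle : OrderDefP L M) {U : (α → M) → Set M}
    (hU : DefFamily L U) {X : (β → M) → Set M} (hX : DefFamily L X) (γ : Type) (f : α → γ)
    (g : β → γ) :
    DefP L fun w : γ → M => Germ (U fun i => w (f i)) (X fun j => w (g j)) := by
  refine .ex₁ (.and ?_ (.all₁ (.imp ?_ (.imp ?_ ?_))))
  · exact hU _ _ _
  · exact hU _ _ _
  · exact hle _ _ _
  · exact hX _ _ _

theorem CompactStructure.exists_altLevel_bound (hM : CompactStructure L M) (hle : OrderDefP L M)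
    [Finite β] {X : (β → M) → Set M} (hX : DefFamily L X)
    (h : ∀ c, ∃ k, PairNIP.altLevel (X c) k = ∅) :
    ∃ k, ∀ c, PairNIP.altLevel (X c) k = ∅ :=
  hM.uniform_bound (fun k => (hX.altLevel hle k).eq_empty)
    (fun c _ _ hij hi => Set.subset_eq_empty (altLevel_antitone (X c) hij) hi) h

theorem CompactStructure.exists_rankLevel_bound (hM : CompactStructure L M) (hle : OrderDefP L M)
    [Finite β] {X : (β → M) → Set M} (hX : DefFamily L X) (h : ∀ c, (X c).Finite) :
    ∃ k, ∀ c, PairNIP.rankLevel (X c) k = ∅ :=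
  hM.uniform_bound (fun k => (hX.rankLevel hle k).eq_empty)
    (fun c _ _ hij hi => Set.subset_eq_empty (rankLevel_antitone (X c) hij) hi)
    fun c => ⟨_, rankLevel_ncard_eq_empty (h c)⟩

end Levels

/-! ### Pairs of structures in two languages -/

/-- The assumptions on a pair: `M` is a compact ordered `L'`-structure, `N` is definable in `L'`,
the definable sets of the reduct to `L` have finitely many alternations locally, and the three
conditions on the `L'`-definable sets hold. -/
structure TamePair (L L' : FirstOrder.Language.{u, v}) {M : Type w} [LinearOrder M]
    [L.Structure M] [L'.Structure M] (N : Set M) : Prop where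
  le : OrderDefP L M
  map : ∀ {α : Type} {P : (α → M) → Prop}, DefP L P → DefP L' P
  pred : ∀ (γ : Type) (a : γ), DefP L' fun w : γ → M => w a ∈ N
  compact : CompactStructure L' M
  locallyConstant : ∀ {r : ℕ} {X : (Fin r → M) → Set M}, DefFamily L X → ∀ d a b c, a < b →
    b < c → ∃ u s v, a ≤ u ∧ u < s ∧ s < v ∧ v ≤ c ∧
      ∀ t t', u < t → t < v → u < t' → t' < v → (t ∈ X d → t' ∈ X d)
  traces : ∀ (n : ℕ) (D : Set (Fin n → M)), (∀ x ∈ D, ∀ i, x i ∈ N) → Set.univ.Definable L' D →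
    D ∈ BooleanSubalgebra.closure {X : Set (Fin n → M) | ∃ S K : Set (Fin n → M),
      Set.univ.Definable L S ∧ (∅ : Set M).Definable L' K ∧ X = S ∩ K}
  special : ∀ D : Set M, Set.univ.Definable₁ L' D →
    D ∈ BooleanSubalgebra.closure {E : Set M | IsSpecialSet L N E}
  isOpen : ∀ D : Set M, Set.univ.Definable₁ L' D → @IsOpen M (Preorder.topology M) D →
    ∃ F : Set (Set M), F.Finite ∧ (∀ I ∈ F, IsOpenInterval I) ∧ D = ⋃₀ F

theorem IsOpenInterval.ordConnected {M : Type w} [LinearOrder M] {I : Set M}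
    (h : IsOpenInterval I) : I.OrdConnected := by
  rcases h with rfl | ⟨b, rfl⟩ | ⟨a, rfl⟩ | ⟨a, b, rfl⟩
  exacts [Set.ordConnected_univ, Set.ordConnected_Iio, Set.ordConnected_Ioi, Set.ordConnected_Ioo]

/-- A member of a boolean subalgebra of sets generated by `𝒢` is determined by finitely many
members of `𝒢`. -/
theorem exists_determining_of_mem_closure {X : Type*} {𝒢 : Set (Set X)} {D : Set X}
    (h : D ∈ BooleanSubalgebra.closure 𝒢) : ∃ (m : ℕ) (G : Fin m → Set X), (∀ j, G j ∈ 𝒢) ∧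
      ∀ x x', (∀ j, x ∈ G j ↔ x' ∈ G j) → x ∈ D → x' ∈ D := by
  obtain ⟨𝒢₀, hsub, hfin, h⟩ : ∃ 𝒢₀ ⊆ 𝒢, 𝒢₀.Finite ∧
      ∀ x x', (∀ G ∈ 𝒢₀, x ∈ G ↔ x' ∈ G) → (x ∈ D ↔ x' ∈ D) := by
    induction h using BooleanSubalgebra.closure_bot_sup_induction with
    | mem D hD =>
      exact ⟨{D}, Set.singleton_subset_iff.2 hD, Set.finite_singleton D, fun x x' h => h D rfl⟩
    | bot => exact ⟨∅, Set.empty_subset _, Set.finite_empty, fun x x' _ => Iff.rfl⟩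
    | sup D _ E _ ihD ihE =>
      obtain ⟨G₁, h₁, f₁, hG₁⟩ := ihD
      obtain ⟨G₂, h₂, f₂, hG₂⟩ := ihE
      exact ⟨G₁ ∪ G₂, Set.union_subset h₁ h₂, f₁.union f₂, fun x x' h =>
        or_congr (hG₁ x x' fun G hG => h G (.inl hG)) (hG₂ x x' fun G hG => h G (.inr hG))⟩
    | compl D _ ih =>
      obtain ⟨G₁, h₁, f₁, hG₁⟩ := ih
      exact ⟨G₁, h₁, f₁, fun x x' h => not_congr (hG₁ x x' h)⟩
  have := hfin.to_subtype
  obtain ⟨m, ⟨e⟩⟩ := Finite.exists_equiv_fin 𝒢₀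
  refine ⟨m, fun j => e.symm j, fun j => hsub (e.symm j).2, fun x x' hx => (h x x' fun G hG => ?_).1⟩
  simpa using hx (e ⟨G, hG⟩)

theorem comp_sumElim {M : Type*} {α β γ : Type*} (w : γ → M) (f : α → γ) (g : β → γ) :
    (fun i => w (Sum.elim f g i)) = Sum.elim (fun i => w (f i)) fun j => w (g j) := by
  funext i
  cases i <;> rfl

theorem DefFamily.definable₁ {L : FirstOrder.Language.{u, v}} {M : Type w} [L.Structure M]
    {β : Type} {X : (β → M) → Set M} (hX : DefFamily L X) (c : β → M) :
    Set.univ.Definable₁ L (X c) :=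
  (hX (Fin 1 ⊕ β) (.inl 0) .inr).definable c

namespace TamePair

variable {L L' : FirstOrder.Language.{u, v}} {M : Type w} [LinearOrder M]
  [L.Structure M] [L'.Structure M] {N : Set M} {β : Type}

theorem le' (hT : TamePair L L' N) : OrderDefP L' M :=
  fun γ a b => hT.map (hT.le γ a b)

theorem mapFamily (hT : TamePair L L' N) {X : (β → M) → Set M} (hX : DefFamily L X) :
    DefFamily L' X :=
  fun γ a f => hT.map (hX γ a f)

theorem exists_altLevel_eq_empty_of_isOpen (hT : TamePair L L' N) {X : (β → M) → Set M}
    (hX : DefFamily L' X) (c : β → M) (ho : @IsOpen M (Preorder.topology M) (X c)) :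
    ∃ k, altLevel (X c) k = ∅ := by
  obtain ⟨F, hF, hI, h⟩ := hT.isOpen (X c) (hX.definable₁ c) ho
  rw [h]
  exact ⟨_, altLevel_sUnion_eq_empty hF fun I hIF => (hI I hIF).ordConnected⟩

/-- The points where neither `X` nor its complement is a neighbourhood. -/
def frontier (X : Set M) : Set M :=
  (inner X ∪ inner Xᶜ)ᶜ

theorem diff_inner_subset_frontier (X : Set M) : X \ inner X ⊆ frontier X := by
  rintro x ⟨hx, hx'⟩ (h | h)
  · exact hx' h
  · exact inner_subset _ h hx

theorem defFamily_frontier (hle : OrderDefP L M) {X : (β → M) → Set M} (hX : DefFamily L X) :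
    DefFamily L fun c => frontier (X c) :=
  ((hX.inner hle).union (hX.compl.inner hle)).compl

/-- The complement of the frontier is open and definable, so by (iii) the frontier has finitely many
alternations. Local constancy puts a point of that complement in every nonempty interval, so the
frontier is finite. -/
theorem finite_frontier [Finite β] (hT : TamePair L L' N) {X : (β → M) → Set M}
    (hX : DefFamily L X) (d : β → M) : (frontier (X d)).Finite := by
  have hU : DefFamily L fun c => inner (X c) ∪ inner (X c)ᶜ :=
    (hX.inner hT.le).union (hX.compl.inner hT.le)
  obtain ⟨k, hk⟩ := hT.exists_altLevel_eq_empty_of_isOpen (hT.mapFamily hU) d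
    (@IsOpen.union M _ _ (Preorder.topology M) (isOpen_inner _) (isOpen_inner _))
  refine finite_of_altLevel (k := k) (by rwa [frontier, altLevel_compl]) fun a b c hab hbc => ?_
  obtain ⟨r, ⟨e⟩⟩ := Finite.exists_equiv_fin β
  obtain ⟨u, s, v, hau, hus, hsv, hvc, h⟩ := hT.locallyConstant
    (X := fun d => X fun i => d (e i)) (fun γ a f => hX γ a fun i => f (e i))
    (fun j => d (e.symm j)) a b c hab hbc
  simp only [Equiv.symm_apply_apply] at h
  refine ⟨s, hau.trans_lt hus, hsv.trans_le hvc, fun hs => hs ?_⟩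
  by_cases hsX : s ∈ X d
  · exact .inl ⟨u, v, hus, hsv, fun t h1 h2 => h s t hus hsv h1 h2 hsX⟩
  · exact .inr ⟨u, v, hus, hsv, fun t h1 h2 ht => hsX (h t s h1 h2 hus hsv ht)⟩

/-- The interior is a finite union of intervals by (iii), and only finitely many frontier points are
missing. -/
theorem exists_altLevel_eq_empty [Finite β] (hT : TamePair L L' N) {X : (β → M) → Set M}
    (hX : DefFamily L X) (d : β → M) : ∃ k, altLevel (X d) k = ∅ := by
  obtain ⟨F, hF, hI, h⟩ := hT.isOpen (inner (X d))
    ((hT.mapFamily (hX.inner hT.le)).definable₁ d) (isOpen_inner _)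
  have hfin : (X d \ inner (X d)).Finite :=
    (hT.finite_frontier hX d).subset (diff_inner_subset_frontier _)
  have hX' : X d = ⋃₀ (F ∪ (fun x => {x}) '' (X d \ inner (X d))) := by
    rw [Set.sUnion_union, ← h, Set.sUnion_image, Set.biUnion_of_singleton, Set.union_sdiff_self,
      Set.union_eq_right.2 (inner_subset _)]
  rw [hX']
  refine ⟨_, altLevel_sUnion_eq_empty (hF.union (hfin.image _)) ?_⟩
  rintro I (hIF | ⟨x, -, rfl⟩)
  · exact (hI I hIF).ordConnected
  · exact Set.ordConnected_singleton

/-- Relations definable in the reduct have polynomial growth. -/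
theorem polyGrowth_reduct (hT : TamePair L L' N) (p : ℕ) :
    ∀ (β : Type) [Finite β] (R : (Fin p → M) → (β → M) → Prop), DefRel L R →
      PolyGrowth Set.univ R := by
  induction p with
  | zero => exact fun β _ R _ => .of_subsingleton _ R
  | succ p ih =>
    intro β _ R hR
    let X : (Fin p ⊕ β → M) → Set M :=
      fun d => {t | R (Fin.cons t fun i => d (.inl i)) fun j => d (.inr j)}
    have hX : DefFamily L X := fun γ a f =>
      (hR γ (Fin.cons a fun i => f (.inl i)) fun j => f (.inr j)).congr fun w => by
        have : (fun i => w ((Fin.cons a fun i => f (.inl i) : Fin (p + 1) → γ) i)) =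
            (Fin.cons (w a) fun i => w (f (.inl i)) : Fin (p + 1) → M) := by
          funext i
          refine Fin.cases rfl (fun i => rfl) i
        rw [this]
        rfl
    obtain ⟨k, hk⟩ := hT.compact.exists_altLevel_bound hT.le' (hT.mapFamily hX)
      (hT.exists_altLevel_eq_empty hX)
    -- The first coordinate has been replaced by a germ, so `Q j` is an `L`-definable relation on
    -- `p`-tuples, with two parameter tuples instead of one.
    let Q : Fin k → (Fin p → M) → (β ⊕ β → M) → Prop := fun j x' d =>
      Germ (altLevel (X (Sum.elim x' fun i => d (.inl i))) j)
        (X (Sum.elim x' fun i => d (.inr i)))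
    have hQ : ∀ j, DefRel L (Q j) := fun j γ f g =>
      (DefFamily.germ hT.le (hX.altLevel hT.le j) hX γ (Sum.elim f fun i => g (.inl i))
        (Sum.elim f fun i => g (.inr i))).congr fun w => by
          rw [comp_sumElim, comp_sumElim]
    have hQ' := fun j => PolyGrowth.comp_param (ih (β ⊕ β) (Q j) (hQ j))
      fun c : (β → M) × (β → M) => Sum.elim c.1 c.2
    refine PolyGrowth.of_branching hQ' fun n c x _ => ?_
    obtain ⟨i, j, hj, h⟩ := exists_germ (fun i => X (Sum.elim (Fin.tail x) (c i)))
      (fun i => hk _) (x 0)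
    refine .inr ⟨i, ⟨j, hj⟩, Fin.tail x, trivial, fun i' => (Iff.trans ?_ (h i'))⟩
    conv_lhs => rw [← Fin.cons_self_tail x]
    rfl

/-- Definable relations between tuples from `N` and tuples from `M` have polynomial growth. -/
theorem polyGrowth_traces [Nonempty M] [Finite β] (hT : TamePair L L' N) {q : ℕ}
    {R : (Fin q → M) → (β → M) → Prop} (hR : DefRel L' R) :
    PolyGrowth {y : Fin q → M | ∀ i, y i ∈ N} R := by
  have hY : DefP L' fun y : Fin q → M => y ∈ {y : Fin q → M | ∀ i, y i ∈ N} :=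
    DefP.forall_index fun i => hT.pred _ i
  refine hT.compact.polyGrowth_of_determined
    (Γ := Σ r : ℕ, L.Formula (Fin q ⊕ Fin r) × L'.Formula (Fin q)) (r := Sigma.fst)
    (Q := fun g y e => g.2.1.Realize (Sum.elim y e) ∧ g.2.2.Realize y) ?_ hY hR ?_ ?_
  · exact fun g γ f f' => .and (hT.map (DefRel.of_formula g.2.1 γ f f'))
      (DefP.reindex ⟨g.2.2, fun _ => Iff.rfl⟩ f)
  -- The factor from `K` has no parameters and contributes at most two patterns.
  · exact fun g => (((hT.polyGrowth_reduct q _ _ (DefRel.of_formula g.2.1)).comp_point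
      (f := id) (Set.mapsTo_univ _ _)).and (PolyGrowth.const (C := Unit) _ g.2.2.Realize)).comp_param
        fun e => (e, ())
  · intro c
    obtain ⟨m, G, hG, h⟩ := exists_determining_of_mem_closure
      (hT.traces q {y | (∀ i, y i ∈ N) ∧ R y c} (fun y hy => hy.1)
        (DefP.definable (P := fun w => (∀ i, w (.inl i) ∈ N) ∧
          R (fun i => w (.inl i)) fun j => w (.inr j))
          (.and (.forall_index fun i => hT.pred _ _) (hR _ _ _)) c))
    choose S K hS hK hSK using hG
    choose r φ e hφ using fun j => exists_defP_of_definable (hS j)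
    choose κ hκ using fun j => exists_formula_of_definable_empty (hK j)
    refine ⟨m, fun j => ⟨r j, φ j, κ j⟩, e, fun x hx x' hx' hxx' hxc =>
      (h x x' (fun j => ?_) ⟨hx, hxc⟩).2⟩
    rw [hSK j]
    simpa only [Set.mem_inter_iff, hφ, hκ] using hxx' j

/-- By `exists_germ` the pattern of a point depends only on a pair `(i, j)`; no point coordinate
remains. -/
theorem polyGrowth_of_altLevel {X : (β → M) → Set M} {k : ℕ}
    (hk : ∀ c, altLevel (X c) k = ∅) : PolyGrowth Set.univ fun t c => t ∈ X c := by
  refine PolyGrowth.of_branching (ι := Fin k) (X' := Unit) (Y' := Set.univ)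
    (Q := fun j _ c => Germ (altLevel (X c.1) j) (X c.2)) (fun j => .of_subsingleton _ _)
    fun n c x _ => ?_
  obtain ⟨i, j, hj, h⟩ := exists_germ (fun i => X (c i)) (fun i => hk _) x
  exact .inr ⟨i, ⟨j, hj⟩, (), trivial, h⟩

/-- Each section of `A` is split into its interior and the finitely many remaining points; the two
resulting families are counted separately. -/
theorem polyGrowth_special [Nonempty M] [Finite β] (hT : TamePair L L' N) {q : ℕ}
    {A : (Fin q ⊕ β → M) → Set M} (hA : DefFamily L A) :
    PolyGrowth Set.univ fun (x : M) (c : β → M) =>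
      ∃ y : Fin q → M, (∀ i, y i ∈ N) ∧ x ∈ A (Sum.elim y c) := by
  have hdef : ∀ {A : (Fin q ⊕ β → M) → Set M}, DefFamily L A → DefFamily L' fun c : β → M =>
      {x : M | ∃ y : Fin q → M, (∀ i, y i ∈ N) ∧ x ∈ A (Sum.elim y c)} := by
    intro A hA γ a f
    refine .ex (.and (.forall_index fun i => ?_) ?_)
    · exact hT.pred _ _
    · exact (hT.mapFamily hA _ (Sum.inl a) (Sum.elim .inr fun j => .inl (f j))).congr fun w => by
        rw [comp_sumElim]
  have hAi := hA.inner hT.le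
  -- the union of the interiors
  have hO : PolyGrowth Set.univ fun (x : M) (c : β → M) =>
      ∃ y : Fin q → M, (∀ i, y i ∈ N) ∧ x ∈ inner (A (Sum.elim y c)) := by
    obtain ⟨k, hk⟩ := hT.compact.exists_altLevel_bound hT.le' (hdef hAi) fun c =>
      hT.exists_altLevel_eq_empty_of_isOpen (hdef hAi) c (by
        let := Preorder.topology M
        have : {x : M | ∃ y : Fin q → M, (∀ i, y i ∈ N) ∧ x ∈ inner (A (Sum.elim y c))} =
            ⋃ y ∈ {y : Fin q → M | ∀ i, y i ∈ N}, inner (A (Sum.elim y c)) := by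
          ext x
          simp
        rw [this]
        exact isOpen_biUnion fun y _ => isOpen_inner _)
    exact polyGrowth_of_altLevel hk
  -- the remaining points
  have hAd : DefFamily L fun d => A d \ inner (A d) := fun γ a f => (hA γ a f).and (hAi γ a f).not
  have hP : PolyGrowth Set.univ fun (x : M) (c : β → M) =>
      ∃ y : Fin q → M, (∀ i, y i ∈ N) ∧
        x ∈ A (Sum.elim y c) \ inner (A (Sum.elim y c)) := by
    have hD := defFamily_frontier hT.le hA
    obtain ⟨k, hk⟩ := hT.compact.exists_rankLevel_bound hT.le' (hT.mapFamily hD)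
      (hT.finite_frontier hA)
    let B : ℕ → (Fin q ⊕ β → M) → Set M := fun j d => rankLevel (frontier (A d)) j
    have hB : ∀ j, DefFamily L' (B j) := fun j => hT.mapFamily (hD.rankLevel hT.le j)
    -- The rank-`j` frontier point of the section given by `y` and the first parameter lies in the
    -- set given by the second. The element `x` is unique, so `y` and `j` code it, and only tuples
    -- from `N` are left to count.
    let Q : Fin k → (Fin q → M) → (β ⊕ β → M) → Prop := fun j y d => ∃ x,
      (x ∈ B j (Sum.elim y fun i => d (.inl i)) ∧ x ∉ B (j + 1) (Sum.elim y fun i => d (.inl i))) ∧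
        ∃ y' : Fin q → M, (∀ i, y' i ∈ N) ∧
          x ∈ A (Sum.elim y' fun i => d (.inr i)) \ inner (A (Sum.elim y' fun i => d (.inr i)))
    have hQ : ∀ j, DefRel L' (Q j) := by
      intro j γ f g
      refine .ex₁ (.and (.and ?_ (.not ?_)) ?_)
      · exact (hB j _ none (Sum.elim (fun i => some (f i)) fun i => some (g (.inl i)))).congr
          fun w => by rw [comp_sumElim]
      · exact (hB (j + 1) _ none (Sum.elim (fun i => some (f i)) fun i => some (g (.inl i)))).congr
          fun w => by rw [comp_sumElim]
      · exact hdef hAd _ none fun i => some (g (.inr i))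
    have hQ' := fun j => PolyGrowth.comp_param (hT.polyGrowth_traces (hQ j))
      fun c : (β → M) × (β → M) => Sum.elim c.1 c.2
    refine PolyGrowth.of_branching hQ' fun n c x _ => ?_
    by_cases h : ∀ i', ¬∃ y : Fin q → M, (∀ i, y i ∈ N) ∧
        x ∈ A (Sum.elim y (c i')) \ inner (A (Sum.elim y (c i')))
    · exact .inl h
    push Not at h
    obtain ⟨i, y, hy, hx⟩ := h
    obtain ⟨j, hjk, hj, hj'⟩ := exists_rankLevel (hk (Sum.elim y (c i)))
      (diff_inner_subset_frontier _ hx)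
    refine .inr ⟨i, ⟨j, hjk⟩, y, hy, fun i' => ⟨fun h => ⟨x, ⟨hj, hj'⟩, h⟩, ?_⟩⟩
    rintro ⟨x', ⟨h1, h2⟩, h⟩
    rwa [rankLevel_unique hj hj' h1 h2]
  convert hO.or hP using 4 with x c
  rw [← exists_or]
  refine exists_congr fun y => ?_
  rw [← and_or_left]
  refine and_congr_right fun _ => ?_
  have := @inner_subset M _ (A (Sum.elim y c)) x
  simp only [Set.mem_sdiff]
  tauto

/-- Definable families of subsets of `M` have polynomial growth. -/
theorem polyGrowth [Nonempty M] [Finite β] (hT : TamePair L L' N) {X : (β → M) → Set M}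
    (hX : DefFamily L' X) : PolyGrowth Set.univ fun t c => t ∈ X c := by
  have key : PolyGrowth Set.univ fun (x : Fin 1 → M) c => x 0 ∈ X c := by
    let A : ∀ g : (Σ q r : ℕ, L.Formula (Fin 1 ⊕ (Fin q ⊕ Fin r))),
        (Fin g.1 ⊕ Fin g.2.1 → M) → Set M := fun g d => {x | g.2.2.Realize (Sum.elim (fun _ => x) d)}
    have hA : ∀ g, DefFamily L (A g) := fun g γ a f =>
      DefRel.of_formula g.2.2 γ (fun _ => a) f
    refine hT.compact.polyGrowth_of_determined
      (Γ := Σ q r : ℕ, L.Formula (Fin 1 ⊕ (Fin q ⊕ Fin r))) (r := fun g => g.2.1)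
      (Q := fun g x e => ∃ y : Fin g.1 → M, (∀ i, y i ∈ N) ∧ x 0 ∈ A g (Sum.elim y e))
      ?_ (.const True) ?_ ?_ ?_
    · intro g γ f f'
      refine .ex (.and (.forall_index fun i => ?_) ?_)
      · exact hT.pred _ _
      · exact (hT.mapFamily (hA g) _ (Sum.inl (f 0)) (Sum.elim .inr fun j => .inl (f' j))).congr
          fun w => by rw [comp_sumElim]
    · exact fun γ f f' => hX γ (f 0) f'
    · exact fun g => (hT.polyGrowth_special (hA g)).comp_point (f := fun x : Fin 1 → M => x 0)
        (Set.mapsTo_univ _ Set.univ)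
    · intro c
      obtain ⟨m, G, hG, h⟩ := exists_determining_of_mem_closure
        (hT.special (X c) (hX.definable₁ c))
      choose q r φ e hqf hE using hG
      refine ⟨m, fun j => ⟨q j, r j, φ j⟩, e, fun x hx x' hx' hxx' => h _ _ fun j => ?_⟩
      rw [hE j]
      exact hxx' j
  exact key.comp_point (f := fun (t : M) (_ : Fin 1) => t) (Set.mapsTo_univ _ Set.univ)

end TamePair

/-! ### Compact models -/

section Models

variable {L : FirstOrder.Language.{u, v}}

theorem realize_iExs_relabel_inr {M : Type*} [L.Structure M] {α : Type} [Finite α]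
    (φ : L.Formula α) :
    M ⊨ ((φ.relabel Sum.inr : L.Formula (Empty ⊕ α)).iExs α : L.Sentence) ↔
      ∃ c : α → M, φ.Realize c := by
  rw [Sentence.Realize, Formula.realize_iExs]
  refine exists_congr fun c => ?_
  rw [Formula.realize_relabel]
  rfl

/-- Existential closures are sentences; this moves counterexamples between elementarily equivalent
structures. -/
theorem exists_realize_iff_of_model_completeTheory {M M' : Type*} [L.Structure M] [L.Structure M']
    (h : M' ⊨ L.completeTheory M) {α : Type} [Finite α] (φ : L.Formula α) :
    (∃ c : α → M', φ.Realize c) ↔ ∃ c : α → M, φ.Realize c := by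
  rw [← realize_iExs_relabel_inr, ← realize_iExs_relabel_inr]
  exact realize_iff_of_model_completeTheory M M' _

/-- Every structure is elementarily equivalent to a compact one. -/
theorem exists_compactStructure (M : Type w) [L.Structure M] [Nonempty M] :
    ∃ M' : Theory.ModelType.{u, v, max u v} (L.completeTheory M), CompactStructure L M' := by
  classical
  let FS : ∀ r : ℕ, Set (L.Formula (Fin r)) → Prop := fun r Φ =>
    ∀ Φ₀ ⊆ Φ, Φ₀.Finite → ∃ c : Fin r → M, ∀ φ ∈ Φ₀, φ.Realize c
  -- A tuple of new constants for every set of formulas `Φ`; the axioms `F` make it realize `Φ`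
  -- whenever `Φ` is finitely satisfiable in `M`.
  let J := Σ r : ℕ, Set (L.Formula (Fin r)) × Fin r
  let P := {p : Σ r : ℕ, Set (L.Formula (Fin r)) × L.Formula (Fin r) //
    FS p.1 p.2.1 ∧ p.2.2 ∈ p.2.1}
  let F : P → L[[J]].Sentence := fun p =>
    Formula.equivSentence (p.1.2.2.relabel fun i => (⟨p.1.1, p.1.2.1, i⟩ : J))
  let T : Finset P → L[[J]].Theory := fun s =>
    (L.lhomWithConstants J).onTheory (L.completeTheory M) ∪ F '' s
  have hdir : Directed (· ⊆ ·) T := Monotone.directed_le (f := T) fun s t hst =>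
    Set.union_subset_union_right _ (Set.image_mono hst)
  have hsat : Theory.IsSatisfiable (⋃ s, T s) := by
    refine (Theory.isSatisfiable_directed_union_iff hdir).2 fun s => ?_
    -- Only finitely many axioms are in play, so `M` itself can interpret each tuple of constants,
    -- with arbitrary values when `Φ` is not finitely satisfiable.
    have hex : ∀ (r : ℕ) (Φ : Set (L.Formula (Fin r))), ∃ c : Fin r → M,
        ∀ p ∈ s, ∀ h : p.1.1 = r, h ▸ p.1.2.1 = Φ → (h ▸ p.1.2.2).Realize c := by
      intro r Φ
      by_cases hΦ : FS r Φ
      · obtain ⟨c, hc⟩ := hΦ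
          {φ | ∃ p ∈ s, ∃ h : p.1.1 = r, h ▸ p.1.2.1 = Φ ∧ φ = h ▸ p.1.2.2} (by
            rintro φ ⟨⟨⟨r', Ψ, ψ⟩, h1, h2⟩, hps, h, hΦ, rfl⟩
            dsimp only at h
            subst h
            subst hΦ
            exact h2) (by
            refine Set.Finite.subset (Set.Finite.image
              (fun p : P => if h : p.1.1 = r then h ▸ p.1.2.2 else ⊥) s.finite_toSet) ?_
            rintro φ ⟨p, hp, h, -, rfl⟩
            exact ⟨p, hp, by simp [h]⟩)
        exact ⟨c, fun p hp h hpΦ => hc _ ⟨p, hp, h, hpΦ, rfl⟩⟩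
      · refine ⟨fun _ => Classical.arbitrary M, ?_⟩
        rintro ⟨⟨r', Ψ, ψ⟩, h1, h2⟩ hp h hpΦ
        dsimp only at h
        subst h
        subst hpΦ
        exact absurd h1 hΦ
    choose ν hν using hex
    let : (constantsOn J).Structure M := constantsOn.structure fun j => ν j.1 j.2.1 j.2.2
    have h1 : M ⊨ (L.lhomWithConstants J).onTheory (L.completeTheory M) :=
      (LHom.onTheory_model _ _).2 inferInstance
    have h2 : M ⊨ F '' s := by
      rw [Theory.model_iff]
      rintro _ ⟨p, hp, rfl⟩
      rw [Formula.realize_equivSentence, Formula.realize_relabel]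
      exact hν p.1.1 p.1.2.1 p hp rfl rfl
    have : M ⊨ T s := h1.union h2
    exact Theory.Model.isSatisfiable M
  obtain ⟨K⟩ := hsat
  let : L.Structure K := (L.lhomWithConstants J).reduct K
  have hK : K ⊨ L.completeTheory M := by
    refine (LHom.onTheory_model (L.lhomWithConstants J) _).1 (Theory.Model.mono K.is_model ?_)
    exact Set.subset_union_left.trans (Set.subset_iUnion T ∅)
  suffices hc : CompactStructure L K from ⟨Theory.ModelType.of _ K, hc⟩
  intro r Φ hcov
  by_contra hno
  push Not at hno
  -- Without a finite subcover, the negated formulas are finitely satisfiable, so their constants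
  -- name a tuple outside the cover.
  have hFS : FS r (Formula.not '' Φ) := by
    intro Ψ hΨ hfin
    choose g hg hg' using hΨ
    have := hfin.to_subtype
    obtain ⟨c, hc⟩ := hno (Set.range fun ψ : Ψ => g ψ.2)
      (by rintro _ ⟨ψ, rfl⟩; exact hg ψ.2) (Set.finite_range _)
    obtain ⟨c', hc'⟩ := (exists_realize_iff_of_model_completeTheory hK
      (Formula.iInf fun ψ : Ψ => ψ.1)).1 ⟨c, by
        rw [Formula.realize_iInf]
        intro ψ
        rw [← hg' ψ.2, Formula.realize_not]
        exact hc _ ⟨ψ, rfl⟩⟩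
    exact ⟨c', fun φ hφ => (Formula.realize_iInf.1 hc') ⟨φ, hφ⟩⟩
  obtain ⟨φ, hφ, hr⟩ := hcov fun i => (L.con (⟨r, Formula.not '' Φ, i⟩ : J) : K)
  have hmem : F ⟨⟨r, Formula.not '' Φ, φ.not⟩, hFS, φ, hφ, rfl⟩ ∈ ⋃ s, T s :=
    Set.mem_iUnion.2 ⟨{_}, .inr ⟨_, Finset.mem_coe.2 (Finset.mem_singleton_self _), rfl⟩⟩
  have hreal := Theory.realize_sentence_of_mem (M := K) _ hmem
  rw [Formula.realize_equivSentence, Formula.realize_relabel, Formula.realize_not] at hreal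
  exact hreal hr

end Models

/-! ### Models of the theory of a pair -/

section PairModels

variable {L : FirstOrder.Language.{u, v}} [L.IsOrdered]

/-- Every model of the theory of a pair comes from a pair. -/
theorem exists_pairStructure_eq {A : Type*} [LinearOrder A] [L.Structure A] [L.OrderedStructure A]
    (B : Set A) {M : Type w} (inst : (langU L).Structure M) (h : M ⊨ pairTheory L B) :
    ∃ (_ : LinearOrder M) (_ : L.Structure M) (_ : L.OrderedStructure M) (N : Set M),
      pairStructure L N = inst := by
  classical
  let iL : L.Structure M := (LHom.sumInl : L →ᴸ langU L).reduct M
  -- The linear order axioms hold in `A`, hence belong to the complete theory of the pair.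
  have hlin : M ⊨ L.linearOrderTheory := by
    refine (LHom.onTheory_model (LHom.sumInl : L →ᴸ langU L) _).1 (Theory.Model.mono h ?_)
    let := predStructure B
    have : A ⊨ (LHom.sumInl : L →ᴸ langU L).onTheory L.linearOrderTheory :=
      (LHom.onTheory_model _ _).2 inferInstance
    exact fun φ hφ => Theory.realize_sentence_of_mem _ hφ
  refine ⟨L.linearOrderOfModels M, iL, ?_,
    {x | Structure.RelMap (L := langU L) (Sum.inr PredRel.U) ![x]}, ?_⟩
  · exact instOrderedStructure L M
  · refine Structure.ext ?_ ?_
    · funext n f x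
      rcases f with f | f
      · rfl
      · exact nomatch f
    · funext n r x
      rcases r with r | r
      · rfl
      · cases r
        refine congr_arg (Structure.RelMap (L := langU L) (M := M) (Sum.inr PredRel.U)) ?_
        funext i
        rw [Subsingleton.elim i 0]
        rfl

/-- The formula `x ≤ y`. -/
def leFormula (L : FirstOrder.Language.{u, v}) [L.IsOrdered] {α : Type} (a b : α) : L.Formula α :=
  (leSymb : L.Relations 2).formula₂ (Term.var a) (Term.var b)

variable {M : Type w} [LinearOrder M] [L.Structure M] [L.OrderedStructure M]

theorem realize_leFormula {α : Type} {a b : α} {w : α → M} :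
    (leFormula L a b).Realize w ↔ w a ≤ w b := by
  rw [leFormula, Formula.realize_rel₂, relMap_leSymb]
  rfl

theorem orderDefP : OrderDefP L M :=
  fun _ a b => ⟨leFormula L a b, fun _ => realize_leFormula⟩

/-- `φ(·, d)` is not constant on any nonempty open interval inside the nonempty open interval
with endpoints `a` and `c`. -/
noncomputable def nowhereConstant {r : ℕ} (φ : L.Formula (Option (Fin r))) :
    L.Formula (Fin r ⊕ Fin 3) :=
  (leFormula L (.inr 1) (.inr 0)).not ⊓ (leFormula L (.inr 2) (.inr 1)).not ⊓
    (Formula.iExs (Fin 3) <|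
      leFormula L (.inl (.inr 0)) (.inr 0) ⊓ (leFormula L (.inr 1) (.inr 0)).not ⊓
      (leFormula L (.inr 2) (.inr 1)).not ⊓ leFormula L (.inr 2) (.inl (.inr 2)) ⊓
      (Formula.iAlls (Fin 2) <|
        (leFormula L (.inr 0) (.inl (.inr 0))).not.imp <|
        (leFormula L (.inl (.inr 2)) (.inr 0)).not.imp <|
        (leFormula L (.inr 1) (.inl (.inr 0))).not.imp <|
        (leFormula L (.inl (.inr 2)) (.inr 1)).not.imp <|
        (φ.relabel fun o => o.elim (.inr 0) fun i => .inl (.inl (.inl i))).imp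
          (φ.relabel fun o => o.elim (.inr 1) fun i => .inl (.inl (.inl i))))).not

theorem realize_nowhereConstant {r : ℕ} {φ : L.Formula (Option (Fin r))}
    {w : Fin r ⊕ Fin 3 → M} :
    (nowhereConstant φ).Realize w ↔ w (.inr 0) < w (.inr 1) ∧ w (.inr 1) < w (.inr 2) ∧
      ¬∃ u s v, w (.inr 0) ≤ u ∧ u < s ∧ s < v ∧ v ≤ w (.inr 2) ∧
        ∀ t t', u < t → t < v → u < t' → t' < v →
          (φ.Realize (fun o => o.elim t fun i => w (.inl i)) →
            φ.Realize fun o => o.elim t' fun i => w (.inl i)) := by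
  simp only [nowhereConstant, Formula.realize_inf, Formula.realize_not, not_le,
    Formula.realize_iExs, Formula.realize_iAlls, realize_leFormula, Formula.realize_imp,
    Formula.realize_relabel, and_assoc]
  refine and_congr_right fun _ => and_congr_right fun _ => not_congr ?_
  have e : ∀ (x : Fin 3 → M) (y : Fin 2 → M) (k : Fin 2),
      ((fun a : ((Fin r ⊕ Fin 3) ⊕ Fin 3) ⊕ Fin 2 => Sum.elim (fun a => Sum.elim w x a) y a) ∘
        fun o : Option (Fin r) => o.elim (Sum.inr k) fun i => Sum.inl (Sum.inl (Sum.inl i))) =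
      fun o => o.elim (y k) fun i => w (.inl i) := by
    intro x y k
    funext o
    cases o <;> rfl
  simp only [e, Sum.elim_inl, Sum.elim_inr]
  constructor
  · rintro ⟨x, h1, h2, h3, h4, h⟩
    exact ⟨x 0, x 1, x 2, h1, h2, h3, h4, fun t t' => h ![t, t']⟩
  · rintro ⟨u, s, v, h1, h2, h3, h4, h⟩
    exact ⟨![u, s, v], h1, h2, h3, h4, fun y => h (y 0) (y 1)⟩

theorem IsOMinimal.not_realize_nowhereConstant (hM : IsOMinimal L M) {r : ℕ}
    (φ : L.Formula (Option (Fin r))) (w : Fin r ⊕ Fin 3 → M) :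
    ¬(nowhereConstant φ).Realize w := by
  rw [realize_nowhereConstant]
  rintro ⟨hab, hbc, h⟩
  let X : (Fin r → M) → Set M := fun d => {t | φ.Realize fun o => o.elim t d}
  have hX : DefFamily L X := .of_defP ⟨φ, fun v => iff_of_eq (congr_arg φ.Realize (by
    funext o
    cases o <;> rfl))⟩
  obtain ⟨F, hF, hI, hFX⟩ := hM _ (hX.definable₁ fun i => w (.inl i))
  have hconv : ∀ I ∈ F, I.OrdConnected := fun I hIF => by
    rcases hI I hIF with h | ⟨a, rfl⟩
    exacts [h.ordConnected, Set.ordConnected_singleton]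
  exact h (exists_constant_Ioo (X := X fun i => w (.inl i))
    (hFX ▸ altLevel_sUnion_eq_empty hF hconv) hab hbc)

theorem tamePair {A : Type*} [LinearOrder A] [L.Structure A] [L.OrderedStructure A]
    (hA : IsOMinimal L A) (B : Set A) (N : Set M) (hN : IsPairModel (pairTheory L B) N)
    (hM : letI := pairStructure L N; CompactStructure (langU L) M)
    (h₁ : CondTraces L N) (h₂ : CondSpecial L N) (h₃ : CondOpen L N) :
    letI := pairStructure L N
    TamePair L (langU L) N := by
  let := predStructure N
  let := predStructure B
  refine ⟨orderDefP, ?_, ?_, hM, ?_, h₁, h₂, h₃⟩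
  · rintro α P ⟨φ, hφ⟩
    exact ⟨(LHom.sumInl : L →ᴸ langU L).onFormula φ, fun v => by
      rw [LHom.realize_onFormula, hφ]⟩
  · intro γ a
    refine ⟨Relations.formula₁ (L := langU L) (Sum.inr PredRel.U) (Term.var a), fun w => ?_⟩
    exact Formula.realize_rel₁.trans Iff.rfl
  · intro r X hX d a b c hab hbc
    -- Failure of local constancy is witnessed by a formula realized in `M`, hence also in `A`,
    -- against o-minimality.
    by_contra hno
    obtain ⟨φ, hφ⟩ := hX (Option (Fin r)) none some
    obtain ⟨w, hw⟩ := (exists_realize_iff_of_model_completeTheory (M := A) hN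
      ((LHom.sumInl : L →ᴸ langU L).onFormula (nowhereConstant φ))).1
        ⟨Sum.elim d ![a, b, c], by
          rw [LHom.realize_onFormula, realize_nowhereConstant]
          simp only [hφ]
          exact ⟨hab, hbc, hno⟩⟩
    rw [LHom.realize_onFormula] at hw
    exact hA.not_realize_nowhereConstant φ w hw

end PairModels

/-! ### Independent patterns -/

section Patterns

variable {L : FirstOrder.Language.{u, v}}

open Classical in
/-- The formula expressing that some element has the pattern `η` with respect to `φ` over the
parameters `w ∘ ρ s`. -/
noncomputable def patternFormula {γ α : Type} (φ : L.Formula (γ ⊕ Fin 1)) {k : ℕ}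
    (ρ : Fin k → γ → α) (η : Fin k → Prop) : L.Formula α :=
  Formula.iExs (Fin 1) <| Formula.iInf fun s =>
    if η s then φ.relabel (Sum.map (ρ s) id) else (φ.relabel (Sum.map (ρ s) id)).not

theorem realize_patternFormula {M : Type*} [L.Structure M] {γ α : Type}
    {φ : L.Formula (γ ⊕ Fin 1)} {k : ℕ} {ρ : Fin k → γ → α} {η : Fin k → Prop} {w : α → M} :
    (patternFormula φ ρ η).Realize w ↔
      ∃ t : Fin 1 → M, ∀ s, φ.Realize (Sum.elim (fun g => w (ρ s g)) t) ↔ η s := by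
  rw [patternFormula, Formula.realize_iExs]
  refine exists_congr fun t => ?_
  rw [Formula.realize_iInf]
  refine forall_congr' fun s => ?_
  have : (fun a => Sum.elim w t a) ∘ Sum.map (ρ s) id = Sum.elim (fun g => w (ρ s g)) t := by
    funext i
    cases i <;> rfl
  split_ifs with h
  · rw [Formula.realize_relabel, this]
    simp [h]
  · rw [Formula.realize_not, Formula.realize_relabel, this]
    simp [h]

/-- No `k` tuples have all patterns with respect to `φ`, for some `k`. -/
def NotIndependent (M : Type w) [L.Structure M] {γ : Type} (φ : L.Formula (γ ⊕ Fin 1)) : Prop :=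
  ∃ k : ℕ, ∀ c : Fin k → γ → M,
    ¬∀ η : Fin k → Prop, ∃ t : Fin 1 → M, ∀ s, φ.Realize (Sum.elim (c s) t) ↔ η s

/-- For fixed `k`, the existence of `k` independent tuples is one sentence: a finite conjunction
over all `η`, existentially quantified. -/
theorem NotIndependent.of_model_completeTheory {M M' : Type*} [L.Structure M] [L.Structure M']
    (h : M' ⊨ L.completeTheory M) {γ : Type} [Finite γ] {φ : L.Formula (γ ⊕ Fin 1)}
    (hφ : NotIndependent M' φ) : NotIndependent M φ := by
  obtain ⟨k, hk⟩ := hφ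
  refine ⟨k, fun c hc => ?_⟩
  obtain ⟨c', hc'⟩ := (exists_realize_iff_of_model_completeTheory h (Formula.iInf
    fun η : Fin k → Prop => patternFormula φ (fun s g => ((s, g) : Fin k × γ)) η)).2
      ⟨fun p => c p.1 p.2, by
        rw [Formula.realize_iInf]
        exact fun η => realize_patternFormula.2 (hc η)⟩
  rw [Formula.realize_iInf] at hc'
  exact hk (fun s g => c' (s, g)) fun η => realize_patternFormula.1 (hc' η)

theorem TamePair.notIndependent {L' : FirstOrder.Language.{u, v}} {M : Type w} [LinearOrder M]
    [L.Structure M] [L'.Structure M] [Nonempty M] {N : Set M} (hT : TamePair L L' N) {γ : Type}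
    [Finite γ] (φ : L'.Formula (γ ⊕ Fin 1)) : NotIndependent M φ := by
  have hX : DefFamily L' fun c : γ → M => {t | φ.Realize (Sum.elim c fun _ => t)} :=
    fun δ a f => DefRel.of_formula φ δ f fun _ => a
  obtain ⟨k, hk⟩ := (hT.polyGrowth hX).exists_not_independent
  refine ⟨k, fun c hc => hk c fun η => ?_⟩
  obtain ⟨t, ht⟩ := hc η
  refine ⟨t 0, fun s => (Iff.of_eq ?_).trans (ht s)⟩
  have : (fun _ => t 0) = t := funext fun i => by rw [Subsingleton.elim i 0]
  rw [Set.mem_ofPred_eq, this]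

end Patterns

/-! ### Reduction to one variable -/

section Indiscernible

variable {L : FirstOrder.Language.{u, v}} {M : Type w} [L.Structure M] {κ : Type}

/-- Indiscernible sequences of tuples with an arbitrary index type. -/
def IndiscernibleSeq (L : FirstOrder.Language.{u, v}) {M : Type w} [L.Structure M] {κ : Type}
    (a : ℕ → κ → M) : Prop :=
  ∀ (k : ℕ) (φ : L.Formula (Fin k × κ)) (i j : Fin k → ℕ), StrictMono i → StrictMono j →
    (φ.Realize (fun s => a (i s.1) s.2) ↔ φ.Realize (fun s => a (j s.1) s.2))

theorem IndiscernibleSeq.realize_iff {a : ℕ → κ → M} (ha : IndiscernibleSeq L a) {I : Type}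
    [LinearOrder I] [Fintype I] (φ : L.Formula (I × κ)) {i j : I → ℕ} (hi : StrictMono i)
    (hj : StrictMono j) :
    φ.Realize (fun s => a (i s.1) s.2) ↔ φ.Realize (fun s => a (j s.1) s.2) := by
  let e : Fin (Fintype.card I) ≃o I := Fintype.orderIsoFinOfCardEq I rfl
  have := ha _ (φ.relabel (Prod.map e.symm id)) (i ∘ e) (j ∘ e) (hi.comp e.strictMono)
    (hj.comp e.strictMono)
  simpa [Formula.realize_relabel, Function.comp_def] using this

/-- Consecutive blocks of an indiscernible sequence form an indiscernible sequence. -/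
theorem IndiscernibleSeq.blocks {a : ℕ → κ → M} (ha : IndiscernibleSeq L a) {k : ℕ}
    {m : ℕ → Fin k → ℕ} (hm : ∀ l, StrictMono (m l))
    (hlt : ∀ l l', l < l' → ∀ s s', m l s < m l' s') :
    IndiscernibleSeq L fun l (p : Fin k × κ) => a (m l p.1) p.2 := by
  intro k' φ i j hi hj
  -- Concatenated blocks are an increasing sequence indexed by the lexicographic product.
  have hmono : ∀ {i : Fin k' → ℕ}, StrictMono i →
      StrictMono fun x : Fin k' ×ₗ Fin k => m (i (ofLex x).1) (ofLex x).2 := by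
    intro i hi x y hxy
    rcases Prod.Lex.lt_iff.1 hxy with h | ⟨h, h'⟩
    · exact hlt _ _ (hi h) _ _
    · simp only [h]
      exact hm _ h'
  have := ha.realize_iff (φ.relabel fun q => (toLex (q.1, q.2.1), q.2.2)) (hmono hi) (hmono hj)
  simpa [Formula.realize_relabel, Function.comp_def] using this

/-- Blocks are chosen recursively, each beyond the maximum of the previous one, with parity
selecting `P` or `Q`. -/
theorem exists_alternating {k : ℕ} {P Q : (Fin k → ℕ) → Prop} (n₀ : ℕ)
    (hP : ∀ n, ∃ i, StrictMono i ∧ (∀ s, n < i s) ∧ P i)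
    (hQ : ∀ n, ∃ i, StrictMono i ∧ (∀ s, n < i s) ∧ Q i) :
    ∃ m : ℕ → Fin k → ℕ, (∀ l, StrictMono (m l)) ∧ (∀ l l', l < l' → ∀ s s', m l s < m l' s') ∧
      (∀ l s, n₀ < m l s) ∧ (∀ l, P (m (2 * l))) ∧ ∀ l, Q (m (2 * l + 1)) := by
  have hall : ∀ l n : ℕ, ∃ i : Fin k → ℕ, StrictMono i ∧ (∀ s, n < i s) ∧
      (Even l → P i) ∧ (¬Even l → Q i) := by
    intro l n
    by_cases hl : Even l
    · obtain ⟨i, h1, h2, h3⟩ := hP n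
      exact ⟨i, h1, h2, fun _ => h3, fun h => absurd hl h⟩
    · obtain ⟨i, h1, h2, h3⟩ := hQ n
      exact ⟨i, h1, h2, fun h => absurd h hl, fun _ => h3⟩
  choose f hf hgt hfP hfQ using hall
  let b : ℕ → ℕ := fun l => Nat.rec n₀ (fun l n => max n (Finset.univ.sup (f l n))) l
  have hb : ∀ l, b (l + 1) = max (b l) (Finset.univ.sup (f l (b l))) := fun l => rfl
  have hbm : Monotone b := monotone_nat_of_le_succ fun l => by rw [hb]; exact le_max_left _ _
  refine ⟨fun l => f l (b l), fun l => hf _ _, fun l l' hl s s' => ?_, fun l s =>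
    (hbm (Nat.zero_le l)).trans_lt (hgt _ _ s), fun l => hfP _ _ (even_two_mul l), fun l =>
    hfQ _ _ (by simp)⟩
  calc f l (b l) s ≤ Finset.univ.sup (f l (b l)) := Finset.le_sup (Finset.mem_univ s)
    _ ≤ b (l + 1) := by rw [hb]; exact le_max_right _ _
    _ ≤ b l' := hbm hl
    _ < f l' (b l') s' := hgt _ _ s'

/-- The truth value of `φ` along indiscernible sequences, with parameters from `M`, is eventually
constant. -/
def EventuallyConstant (M : Type w) [L.Structure M] {κ : Type} {q : ℕ}
    (φ : L.Formula (κ ⊕ Fin q)) : Prop :=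
  ∀ a : ℕ → κ → M, IndiscernibleSeq L a → ∀ b : Fin q → M, ∃ i₀ : ℕ, ∀ i j, i₀ < i → i₀ < j →
    φ.Realize (Sum.elim (a i) b) → φ.Realize (Sum.elim (a j) b)

/-- Otherwise blocks on which `δ` holds and fails would alternate along an indiscernible sequence of
blocks. -/
theorem EventuallyConstant.tail {q k : ℕ} {δ : L.Formula ((Fin k × κ) ⊕ Fin q)}
    (hδ : EventuallyConstant M δ) {a : ℕ → κ → M} (ha : IndiscernibleSeq L a) (b : Fin q → M) :
    ∃ i₀ : ℕ, ∀ i j : Fin k → ℕ, StrictMono i → StrictMono j → (∀ s, i₀ < i s) → (∀ s, i₀ < j s) →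
      δ.Realize (Sum.elim (fun p => a (i p.1) p.2) b) →
        δ.Realize (Sum.elim (fun p => a (j p.1) p.2) b) := by
  by_contra hno
  push Not at hno
  obtain ⟨m, hm, hlt, -, hP, hQ⟩ := exists_alternating
    (P := fun i => δ.Realize (Sum.elim (fun p => a (i p.1) p.2) b))
    (Q := fun i => ¬δ.Realize (Sum.elim (fun p => a (i p.1) p.2) b)) 0
    (fun n => by obtain ⟨i, j, h1, h2, h3, h4, h5, h6⟩ := hno n; exact ⟨i, h1, h3, h5⟩)
    (fun n => by obtain ⟨i, j, h1, h2, h3, h4, h5, h6⟩ := hno n; exact ⟨j, h2, h4, h6⟩)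
  obtain ⟨i₀, h⟩ := hδ _ (ha.blocks hm hlt) b
  exact hQ (i₀ + 1) (h (2 * (i₀ + 1)) (2 * (i₀ + 1) + 1) (by omega) (by omega) (hP (i₀ + 1)))

/-- If formulas with one object variable are not independent, then all formulas are eventually
constant along indiscernible sequences. -/
theorem eventuallyConstant_of_notIndependent
    (hM : ∀ (γ : Type) [Finite γ] (φ : L.Formula (γ ⊕ Fin 1)), NotIndependent M φ) (q : ℕ) :
    ∀ (κ : Type) [Finite κ] (φ : L.Formula (κ ⊕ Fin q)), EventuallyConstant M φ := by
  classical
  induction q with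
  | zero =>
    intro κ _ φ a ha b
    refine ⟨0, fun i j _ _ h => ?_⟩
    have hrel : ∀ i, φ.Realize (Sum.elim (a i) b) ↔
        (φ.relabel (Sum.elim (fun x => ((0 : Fin 1), x)) Fin.elim0)).Realize
          (fun s : Fin 1 × κ => a ((fun _ => i) s.1) s.2) := by
      intro i
      rw [Formula.realize_relabel]
      refine iff_of_eq (congr_arg φ.Realize ?_)
      funext x
      rcases x with x | x
      · rfl
      · exact x.elim0
    rw [hrel] at h ⊢
    exact (ha 1 _ (fun _ => i) (fun _ => j) (Subsingleton.strictMono _)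
      (Subsingleton.strictMono _)).1 h
  | succ q ih =>
    intro κ _ φ a ha b
    -- The parameter `b 0` becomes the single object variable; the other `q` parameters stay fixed.
    let φ' : L.Formula ((κ ⊕ Fin q) ⊕ Fin 1) :=
      φ.relabel (Sum.elim (fun x => .inl (.inl x)) (Fin.cases (.inr 0) fun i => .inl (.inr i)))
    have hφ' : ∀ (x : κ → M) (t : Fin 1 → M), t 0 = b 0 →
        (φ'.Realize (Sum.elim (Sum.elim x (Fin.tail b)) t) ↔ φ.Realize (Sum.elim x b)) := by
      intro x t ht
      rw [Formula.realize_relabel]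
      refine iff_of_eq (congr_arg φ.Realize ?_)
      funext y
      rcases y with y | y
      · rfl
      · refine Fin.cases ht (fun y => rfl) y
    obtain ⟨k, hk⟩ := hM _ φ'
    let δ : (Fin k → Prop) → L.Formula ((Fin k × κ) ⊕ Fin q) :=
      patternFormula φ' fun s => Sum.map (Prod.mk s) id
    have hδ : ∀ η (i : Fin k → ℕ),
        (δ η).Realize (Sum.elim (fun p => a (i p.1) p.2) (Fin.tail b)) ↔ ∃ t : Fin 1 → M,
          ∀ s, φ'.Realize (Sum.elim (Sum.elim (a (i s)) (Fin.tail b)) t) ↔ η s := by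
      intro η i
      rw [realize_patternFormula]
      refine exists_congr fun t => forall_congr' fun s => ?_
      have : (fun g => Sum.elim (fun p : Fin k × κ => a (i p.1) p.2) (Fin.tail b)
          (Sum.map (Prod.mk s) id g)) = Sum.elim (a (i s)) (Fin.tail b) := by
        funext g
        cases g <;> rfl
      rw [this]
    choose i₀ hi₀ using fun η => (ih _ (δ η)).tail ha (Fin.tail b)
    obtain ⟨n₀, hn₀⟩ := (Set.finite_range i₀).bddAbove
    by_contra hno
    push Not at hno
    obtain ⟨m, -, hlt, hgt, hP, hQ⟩ := exists_alternating (k := 1)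
      (P := fun i => φ.Realize (Sum.elim (a (i 0)) b))
      (Q := fun i => ¬φ.Realize (Sum.elim (a (i 0)) b)) n₀
      (fun n => by
        obtain ⟨i, j, h1, h2, h3, h4⟩ := hno n
        exact ⟨fun _ => i, Subsingleton.strictMono _, fun _ => h1, h3⟩)
      (fun n => by
        obtain ⟨i, j, h1, h2, h3, h4⟩ := hno n
        exact ⟨fun _ => j, Subsingleton.strictMono _, fun _ => h2, h4⟩)
    -- One fixed block beyond `n₀` is shown to be independent. For each `η`, another late block
    -- realizes `η` through `b 0`, and by induction `δ η` has the same truth value on both blocks.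
    refine hk (fun s => Sum.elim (a (n₀ + 1 + s)) (Fin.tail b)) fun η => ?_
    rw [← hδ η fun s => n₀ + 1 + s]
    have hn : i₀ η ≤ n₀ := hn₀ ⟨η, rfl⟩
    -- Along `m`, `φ` holds at even and fails at odd positions; from each consecutive pair the
    -- position prescribed by `η` is taken.
    refine hi₀ η (fun s => m (2 * (s : ℕ) + if η s then 0 else 1) 0) (fun s => n₀ + 1 + s)
      (fun s s' hs => ?_)
      (fun s s' hs => Nat.add_lt_add_left hs _) (fun s => hn.trans_lt (hgt _ _))
      (fun s => by omega) ((hδ η fun s => m (2 * (s : ℕ) + if η s then 0 else 1) 0).2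
        ⟨fun _ => b 0, fun s => ?_⟩)
    · refine hlt _ _ ?_ _ _
      have : (s : ℕ) < s' := hs
      split_ifs <;> omega
    · rw [hφ' _ _ rfl]
      split_ifs with h
      · exact iff_of_true (hP s) h
      · exact iff_of_false (hQ s) h

end Indiscernible

/-- The theory of a pair satisfying the three conditions in all its models is dependent. -/
theorem dependent_pairTheory (L : FirstOrder.Language.{u, v}) [L.IsOrdered]
    (A : Type w) [LinearOrder A] [L.Structure A] [L.OrderedStructure A]
    (hA : IsOMinimal L A) (B : Set A)
    (hmodels : ∀ (M : Type (max u v)) [LinearOrder M] [L.Structure M] [L.OrderedStructure M]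
      (N : Set M), IsPairModel (pairTheory L B) N →
        CondTraces L N ∧ CondSpecial L N ∧ CondOpen L N) :
    Dependent (pairTheory L B) := by
  intro p q φ M a ha b
  have hM : ∀ (γ : Type) [Finite γ] (φ : (langU L).Formula (γ ⊕ Fin 1)), NotIndependent M φ := by
    intro γ _ φ
    obtain ⟨@⟨K, iK, hK, hne⟩, hcompact⟩ := exists_compactStructure (L := langU L) M
    refine NotIndependent.of_model_completeTheory (M' := K) hK ?_
    -- `K` is built from the theory of `M`, which contains the theory of the pair, so the three
    -- conditions apply to `K`.
    have hKB : K ⊨ pairTheory L B := FirstOrder.Language.Theory.Model.mono hK fun σ hσ =>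
      Language.mem_completeTheory.2 (Language.Theory.realize_sentence_of_mem (M := M) _ hσ)
    obtain ⟨_, _, _, N, rfl⟩ := exists_pairStructure_eq B iK hKB
    obtain ⟨h₁, h₂, h₃⟩ := hmodels K N hKB
    let := pairStructure L N
    have hT : TamePair L (langU L) N := tamePair hA B N hKB hcompact h₁ h₂ h₃
    exact hT.notIndependent φ
  obtain ⟨i₀, h⟩ := eventuallyConstant_of_notIndependent hM q (Fin p) φ a ha b
  refine ⟨i₀, ?_⟩
  by_cases h' : ∃ i, i₀ < i ∧ φ.Realize (Sum.elim (a i) b)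
  · obtain ⟨i, hi, hi'⟩ := h'
    exact .inl fun j hj => h i j hi hj hi'
  · push Not at h'
    exact .inr h'

end PairNIP

theorem mainTheorem5 (L : FirstOrder.Language.{u, v}) [L.IsOrdered]
    (A : Type w) [LinearOrder A] [L.Structure A] [L.OrderedStructure A]
    (hA : PairNIP.IsOMinimal L A) (B : Set A)
    (hmodels : ∀ (M : Type (max u v)) [LinearOrder M] [L.Structure M] [L.OrderedStructure M]
      (N : Set M), PairNIP.IsPairModel (PairNIP.pairTheory L B) N →
        PairNIP.CondTraces L N ∧ PairNIP.CondSpecial L N ∧ PairNIP.CondOpen L N) :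
    PairNIP.Dependent (PairNIP.pairTheory L B) :=
  PairNIP.dependent_pairTheory L A hA B hmodels
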